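/- All functions are real-valued and Lebesgue measurable on $(0,\infty)$, and functions equal almost everywhere are identified. For such $f$, let $f^*(t)=\inf\{s\ge 0:|\{x:|f(x)|>s\}|\le t\}$ be the decreasing rearrangement, $f^{**}(t)=\frac1t\int_0^t f^*(s)\,ds$, and $Sf(t)=\frac1t\int_0^t f(r)\,dr$ the Hardy operator. A function $\varphi:(0,\infty)\to(0,\infty)$ is quasi-concave if $\varphi$ is increasing and $\varphi(t)/t$ is decreasing (both in the weak sense); put $\varphi(0)=0$ and $$\|f\|_{\Lambda_\varphi}=\int_{[0,\infty)}f^*\,d\varphi=\varphi(0+)\,f^*(0+)+\int_{(0,\infty)}f^*\,d\varphi,\qquad \Lambda_\varphi=\{f:\|f\|_{\Lambda_\varphi}<\infty\}.$$ An r.i. Banach function space is a space $Y=\{f:\rho(|f|)<\infty\}$ with $\|f\|_Y=\rho(|f|)$, where $\rho$ is a rearrangement invariant Banach function norm in the sense of Bennett and Sharpley: $\rho$ maps the measurable $[0,\infty]$-valued functions on $(0,\infty)$ to $[0,\infty]$; $\rho(f)=0$ iff $f=0$ a.e.; $\rho(af)=a\rho(f)$ for real $a\ge0$; $\rho(f+g)\le\rho(f)+\rho(g)$;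 $f\le g$ a.e. implies $\rho(f)\le\rho(g)$; $f_n\uparrow f$ a.e. implies $\rho(f_n)\uparrow\rho(f)$; if $|E|<\infty$ then $\rho(\chi_E)<\infty$ and $\int_E f\le C_E\,\rho(f)$ for all $f$, with a finite constant $C_E$; and $\rho(f)=\rho(g)$ whenever $f,g$ are equimeasurable. Let $\mathfrak R[S,\Lambda_\varphi]$ denote the minimal r.i. Banach function space $Y$ such that $S:\Lambda_\varphi\to Y$ is bounded (i.e. $\|Sf\|_Y\le C\|f\|_{\Lambda_\varphi}$ for all $f\in\Lambda_\varphi$), minimal meaning that $Y$ is contained in every other such space; if it exists, it is unique up to equivalence of norms. **Theorem 2.3.** Let $\varphi$ be quasi-concave. Then there is a constant $C>0$ with $$\varphi(t)\ge C\,t\log(1+1/t)\qquad\text{for all }t>0$$ if and only if the space $\mathfrak R[S,\Lambda_\varphi]$ exists. In this case $$X=\{f\in L^1+L^\infty:\ f^{**}\le (Sg)^{**}\text{ on }(0,\infty)\text{ for some decreasing }g\in\Lambda_\varphi\},$$ endowed with $$\|f\|_X=\inf\{\|g\|_{\Lambda_\varphi}:\ g\in\Lambda_\varphi\text{ decreasing},\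 f^{**}\le (Sg)^{**}\text{ on }(0,\infty)\},$$ is an r.i. Banach function space and is a minimal one for which $S:\Lambda_\varphi\to X$ is bounded; and every minimal such space coincides with $X$ as a set, with equivalent norms. -/

import Mathlib

open MeasureTheory Set
open scoped ENNReal NNReal

noncomputable section

namespace HardyRange

/-- Lebesgue measure on the half-line `(0, ∞)`. -/
def μ : Measure ℝ := volume.restrict (Ioi 0)

/-- Quasi-concave functions on `(0, ∞)` (only the values `φ t` for `t > 0` matter). -/
structure QuasiConcave (φ : ℝ → ℝ) : Prop where
  pos : ∀ t, 0 < t → 0 < φ t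
  mono : MonotoneOn φ (Ioi 0)
  anti : AntitoneOn (fun t => φ t / t) (Ioi 0)

/-- Extension of `φ` to the real line by `0` on `(-∞, 0]`. -/
def extendZero (φ : ℝ → ℝ) (t : ℝ) : ℝ := if 0 < t then φ t else 0

theorem QuasiConcave.monotone_extendZero {φ : ℝ → ℝ} (hφ : QuasiConcave φ) :
    Monotone (extendZero φ) := by
  intro s t hst
  unfold extendZero
  split_ifs with hs ht ht
  · exact hφ.mono hs ht hst
  · exact absurd (hs.trans_le hst) ht
  · exact (hφ.pos t ht).le
  · exact le_rfl

/-- The Lebesgue-Stieltjes measure `dφ` on `[0, ∞)`, with the convention `φ(0) = 0`: it has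
an atom of mass `φ(0+)` at the origin. -/
def QuasiConcave.dφ {φ : ℝ → ℝ} (hφ : QuasiConcave φ) : Measure ℝ :=
  hφ.monotone_extendZero.stieltjesFunction.measure

/-- The distribution function `s ↦ |{x > 0 : f x > s}|`. -/
def distr (f : ℝ → ℝ≥0∞) (s : ℝ≥0∞) : ℝ≥0∞ := μ {x | s < f x}

/-- The decreasing rearrangement `f*` (for `t ≥ 0`). -/
def rearr (f : ℝ → ℝ≥0∞) (t : ℝ) : ℝ≥0∞ :=
  sInf {s : ℝ≥0∞ | distr f s ≤ ENNReal.ofReal t}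

/-- The maximal function `f**(t) = (1/t) ∫₀ᵗ f*(s) ds` (for `t > 0`). -/
def maxRearr (f : ℝ → ℝ≥0∞) (t : ℝ) : ℝ≥0∞ :=
  (ENNReal.ofReal t)⁻¹ * ∫⁻ s in Ioc 0 t, rearr f s

/-- The absolute value of a real function, as a function with values in `[0, ∞]`. -/
def absFun (f : ℝ → ℝ) (x : ℝ) : ℝ≥0∞ := ‖f x‖ₑ

/-- `‖f‖_{Λ_φ} = ∫_{[0,∞)} f* dφ`. -/
def lorentzNorm {φ : ℝ → ℝ} (hφ : QuasiConcave φ) (f : ℝ → ℝ) : ℝ≥0∞ :=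
  ∫⁻ t, rearr (absFun f) t ∂hφ.dφ

/-- The minimal Lorentz space `Λ_φ`. -/
def lorentzSpace {φ : ℝ → ℝ} (hφ : QuasiConcave φ) : Set (ℝ → ℝ) :=
  {f | AEMeasurable f μ ∧ lorentzNorm hφ f < ∞}

/-- The Hardy operator `S f(t) = (1/t) ∫₀ᵗ f(r) dr`. -/
def hardy (f : ℝ → ℝ) (t : ℝ) : ℝ := (1 / t) * ∫ r in (0 : ℝ)..t, f r

/-- Rearrangement invariant Banach function norms over `(0, ∞)` in the sense of Bennett and
Sharpley, as functionals on the cone of `[0, ∞]`-valued measurable functions: the norm axioms,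
the lattice property, the Fatou property, finiteness on sets of finite measure, integrability
over sets of finite measure, and invariance under equimeasurability. -/
structure IsRIBanachFunctionNorm (ρ : (ℝ → ℝ≥0∞) → ℝ≥0∞) : Prop where
  eq_zero_iff : ∀ f, AEMeasurable f μ → (ρ f = 0 ↔ f =ᵐ[μ] 0)
  smul : ∀ (a : ℝ≥0) f, AEMeasurable f μ → ρ (fun x => (a : ℝ≥0∞) * f x) = a * ρ f
  add_le : ∀ f g, AEMeasurable f μ → AEMeasurable g μ →
    ρ (fun x => f x + g x) ≤ ρ f + ρ g
  mono : ∀ f g, AEMeasurable f μ → AEMeasurable g μ → (∀ᵐ x ∂μ, f x ≤ g x) → ρ f ≤ ρ g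
  fatou : ∀ f : ℕ → ℝ → ℝ≥0∞, (∀ n, AEMeasurable (f n) μ) →
    (∀ᵐ x ∂μ, Monotone fun n => f n x) → ρ (fun x => ⨆ n, f n x) = ⨆ n, ρ (f n)
  indicator_lt_top : ∀ E : Set ℝ, MeasurableSet E → μ E < ∞ →
    ρ (E.indicator fun _ => 1) < ∞
  lintegral_le : ∀ E : Set ℝ, MeasurableSet E → μ E < ∞ →
    ∃ C : ℝ≥0, ∀ f, AEMeasurable f μ → ∫⁻ x in E, f x ∂μ ≤ C * ρ f
  rearrangement_invariant : ∀ f g, AEMeasurable f μ → AEMeasurable g μ →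
    (∀ s, distr f s = distr g s) → ρ f = ρ g

/-- The function space `{f : ρ(|f|) < ∞}` generated by a function norm. -/
def functionSpace (ρ : (ℝ → ℝ≥0∞) → ℝ≥0∞) : Set (ℝ → ℝ) :=
  {f | AEMeasurable f μ ∧ ρ (absFun f) < ∞}

/-- `S` maps `Λ_φ` boundedly into the space generated by `ρ`. -/
def HardyBounded {φ : ℝ → ℝ} (hφ : QuasiConcave φ) (ρ : (ℝ → ℝ≥0∞) → ℝ≥0∞) : Prop :=
  ∃ C : ℝ≥0, ∀ f ∈ lorentzSpace hφ, ρ (absFun (hardy f)) ≤ C * lorentzNorm hφ f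

/-- `ρ` generates the minimal r.i. Banach function space `Y` such that `S : Λ_φ → Y` is
bounded, i.e. the smallest one with respect to inclusion. -/
structure IsMinimalRange {φ : ℝ → ℝ} (hφ : QuasiConcave φ) (ρ : (ℝ → ℝ≥0∞) → ℝ≥0∞) :
    Prop where
  isRI : IsRIBanachFunctionNorm ρ
  bounded : HardyBounded hφ ρ
  minimal : ∀ σ, IsRIBanachFunctionNorm σ → HardyBounded hφ σ →
    functionSpace ρ ⊆ functionSpace σ

/-- The space `L¹ + L^∞` over `(0, ∞)`. -/
def L1AddLinfty : Set (ℝ → ℝ) :=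
  {f | ∃ a b : ℝ → ℝ, MemLp a 1 μ ∧ MemLp b ∞ μ ∧ f =ᵐ[μ] a + b}

/-- The decreasing functions `g ∈ Λ_φ` with `f** ≤ (S g)**` on `(0, ∞)`. -/
def majorants {φ : ℝ → ℝ} (hφ : QuasiConcave φ) (f : ℝ → ℝ≥0∞) : Set (ℝ → ℝ) :=
  {g | AntitoneOn g (Ioi 0) ∧ g ∈ lorentzSpace hφ ∧
    ∀ t, 0 < t → maxRearr f t ≤ maxRearr (absFun (hardy g)) t}

/-- The space of all `f ∈ L¹ + L^∞` with `f** ≤ (S g)**` for some decreasing `g ∈ Λ_φ`. -/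
def rangeSpace {φ : ℝ → ℝ} (hφ : QuasiConcave φ) : Set (ℝ → ℝ) :=
  {f | f ∈ L1AddLinfty ∧ (majorants hφ (absFun f)).Nonempty}

/-- The norm `inf ‖g‖_{Λ_φ}` over the decreasing `g ∈ Λ_φ` with `f** ≤ (S g)**`, as a functional
on `[0, ∞]`-valued functions; it is `∞` when there is no such `g` or when `f` is not a.e. equal
to the absolute value of a function in `L¹ + L^∞`. -/
def rangeNorm {φ : ℝ → ℝ} (hφ : QuasiConcave φ) (f : ℝ → ℝ≥0∞) : ℝ≥0∞ :=
  ⨅ (g : ℝ → ℝ) (_ : (∃ h ∈ L1AddLinfty, f =ᵐ[μ] absFun h) ∧ g ∈ majorants hφ f),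
    lorentzNorm hφ g

end HardyRange

end

/-!
Since `f** ≤ (S g)**` says that the integrals `∫₀ᵗ f*` are dominated by `∫₀ᵗ S g*`, the norm
`rangeNorm` is the infimum of `∫ G dφ` over the decreasing `G ≥ 0` whose Hardy average
submajorizes `f`. The growth condition bounds `∫₀ᵗ S G` by `∫ G dφ`: both are linear in `G`, so it
is enough to compare them on `G = χ_(0, d)`, where they are `d (1 + log (t / d))` and `φ d`. Testing
the boundedness of `S` on the same indicators gives the necessity of the condition.

For the Fatou property, Helly's selection theorem extracts a limit of nearly optimal majorants. The
mass that escapes to the origin contributes to `∫₀ᵗ S G` a constant not exceeding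
`limsup_{d → 0} d (1 + log (1 / d)) / φ d` per unit of `∫ G dφ`, and a correction concentrated near
the origin recovers this loss at almost the same price.

Minimality holds because every rearrangement invariant norm is monotone under submajorization: by
Rado's theorem a submajorized step function lies below a convex combination of permutations of the
larger one, and the general case follows by dyadic approximation. Finally, an inclusion between
Banach function spaces is automatically bounded, whence the equivalence of the norms.
-/

namespace HardyRange

open Filter
open scoped Topology Function

theorem lintegral_eq_lintegral_meas_ofReal_lt {α : Type*} [MeasurableSpace α] {ν : Measure α}
    {f : α → ℝ≥0∞} (hf : AEMeasurable f ν) :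
    ∫⁻ x, f x ∂ν = ∫⁻ s in Ioi (0 : ℝ), ν {x | ENNReal.ofReal s < f x} := by
  by_cases htop : ν {x | f x = ∞} = 0
  · have hfin : ∀ᵐ x ∂ν, f x ≠ ∞ := measure_eq_zero_iff_ae_notMem.1 htop
    calc ∫⁻ x, f x ∂ν = ∫⁻ x, ENNReal.ofReal (f x).toReal ∂ν :=
          lintegral_congr_ae (hfin.mono fun x hx => (ENNReal.ofReal_toReal hx).symm)
      _ = ∫⁻ s in Ioi (0 : ℝ), ν {x | s < (f x).toReal} :=
          lintegral_eq_lintegral_meas_lt ν (.of_forall fun _ => ENNReal.toReal_nonneg)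
            hf.ennreal_toReal
      _ = _ := setLIntegral_congr_fun measurableSet_Ioi fun s hs => by
          refine measure_congr (hfin.mono fun x hx => propext ?_)
          exact (ENNReal.ofReal_lt_iff_lt_toReal (le_of_lt hs) hx).symm
  · rw [lintegral_eq_top_of_measure_eq_top_ne_zero hf htop, eq_comm, eq_top_iff]
    calc ∞ = ∫⁻ _ in Ioi (0 : ℝ), ν {x | f x = ∞} := by
          rw [setLIntegral_const, Real.volume_Ioi, ENNReal.mul_top htop]
      _ ≤ _ := lintegral_mono fun s => measure_mono fun x (hx : f x = ∞) => by simp [hx]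

theorem setLIntegral_le_lintegral_sub_add {α : Type*} [MeasurableSpace α] {ν : Measure α}
    (f : α → ℝ≥0∞) (E : Set α) (c : ℝ≥0∞) :
    ∫⁻ x in E, f x ∂ν ≤ ∫⁻ x, (f x - c) ∂ν + c * ν E :=
  calc ∫⁻ x in E, f x ∂ν ≤ ∫⁻ x in E, ((f x - c) + c) ∂ν := lintegral_mono fun _ => le_tsub_add
    _ = ∫⁻ x in E, (f x - c) ∂ν + c * ν E := by
        rw [lintegral_add_right _ measurable_const, setLIntegral_const]
    _ ≤ _ := by gcongr; exact Measure.restrict_le_self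

theorem lintegral_eq_iSup_min_natCast {α : Type*} [MeasurableSpace α] (ν : Measure α)
    {f : α → ℝ≥0∞} (hf : Measurable f) :
    ∫⁻ x, f x ∂ν = ⨆ n : ℕ, ∫⁻ x, min (f x) n ∂ν := by
  rw [← lintegral_iSup fun n => hf.min measurable_const]
  · refine lintegral_congr fun x => ?_
    have h : (⨆ n : ℕ, min (f x) (n : ℝ≥0∞)) = min (f x) (⨆ n : ℕ, (n : ℝ≥0∞)) :=
      (inf_iSup_eq _ _).symm
    rw [h, ENNReal.iSup_natCast, min_eq_left le_top]
  · exact fun m n hmn x => min_le_min_left _ (by exact_mod_cast hmn)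

theorem ae_μ_of_forall {p : ℝ → Prop} (h : ∀ x, 0 < x → p x) : ∀ᵐ x ∂μ, p x :=
  (ae_restrict_iff' measurableSet_Ioi).2 (.of_forall h)

theorem μ_restrict_Ioc (t : ℝ) : μ.restrict (Ioc 0 t) = volume.restrict (Ioc 0 t) := by
  rw [μ, Measure.restrict_restrict measurableSet_Ioc, inter_eq_left.2 Ioc_subset_Ioi_self]

theorem μ_Ioc (t : ℝ) : μ (Ioc 0 t) = ENNReal.ofReal t := by
  rw [← Measure.restrict_apply_self, μ_restrict_Ioc, Measure.restrict_apply_self,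
    Real.volume_Ioc, sub_zero]

theorem μ_ofReal_lt (d : ℝ≥0∞) : μ {t | ENNReal.ofReal t < d} = d := by
  rw [μ, Measure.restrict_apply' measurableSet_Ioi]
  by_cases hd : d = ∞
  · simp [hd]
  · have : {t : ℝ | ENNReal.ofReal t < d} ∩ Ioi 0 = Ioo 0 d.toReal := by
      ext t
      rw [inter_comm]
      exact and_congr_right fun ht => ENNReal.ofReal_lt_iff_lt_toReal (le_of_lt ht) hd
    rw [this, Real.volume_Ioo, sub_zero, ENNReal.ofReal_toReal hd]

section Distribution

variable {f g : ℝ → ℝ≥0∞}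

theorem distr_congr (h : f =ᵐ[μ] g) (s : ℝ≥0∞) : distr f s = distr g s :=
  measure_congr (h.mono fun _ hx => congrArg (s < ·) hx)

theorem distr_mono (h : ∀ᵐ x ∂μ, f x ≤ g x) (s : ℝ≥0∞) : distr f s ≤ distr g s :=
  measure_mono_ae (h.mono fun _ hx hs => lt_of_lt_of_le hs hx)

theorem antitone_distr (f : ℝ → ℝ≥0∞) : Antitone (distr f) := fun _ _ h =>
  measure_mono fun _ hx => lt_of_le_of_lt h hx

theorem distr_iSup {f : ℕ → ℝ → ℝ≥0∞} (hmono : ∀ᵐ x ∂μ, Monotone fun n => f n x) (s : ℝ≥0∞) :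
    distr (fun x => ⨆ n, f n x) s = ⨆ n, distr (f n) s := by
  refine le_antisymm ?_ (iSup_le fun n => distr_mono (.of_forall fun x => le_iSup (f · x) n) s)
  have h : {x | s < ⨆ n, f n x} = ⋃ n, {x | s < f n x} := by
    ext x; simp [lt_iSup_iff]
  rw [distr, h, measure_iUnion_eq_iSup_accumulate]
  refine iSup_mono fun n => measure_mono_ae ?_
  filter_upwards [hmono] with x hx hxn
  obtain ⟨m, hm, hsm⟩ := mem_accumulate.1 hxn
  exact lt_of_lt_of_le hsm (hx hm)

theorem distr_rearr_le (f : ℝ → ℝ≥0∞) (t : ℝ) : distr f (rearr f t) ≤ ENNReal.ofReal t := by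
  by_cases h : rearr f t = ∞
  · simp [distr, h]
  obtain ⟨u, hanti, hu, hlim⟩ := exists_seq_strictAnti_tendsto' (lt_top_iff_ne_top.2 h)
  have hU : {x | rearr f t < f x} = ⋃ n, {x | u n < f x} := by
    ext x
    simp only [mem_ofPred_eq, mem_iUnion]
    exact ⟨fun hx => (hlim.eventually_lt_const hx).exists, fun ⟨n, hn⟩ => (hu n).1.trans hn⟩
  have hdir : Directed (· ⊆ ·) fun n => {x | u n < f x} :=
    directed_of_isDirected_le fun m n hmn x (hx : u m < f x) =>
      lt_of_le_of_lt (hanti.antitone hmn) hx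
  rw [distr, hU, hdir.measure_iUnion]
  refine iSup_le fun n => ?_
  obtain ⟨s, hs, hsu⟩ := sInf_lt_iff.1 (hu n).1
  exact (antitone_distr f hsu.le).trans hs

theorem rearr_le_iff {t : ℝ} {s : ℝ≥0∞} : rearr f t ≤ s ↔ distr f s ≤ ENNReal.ofReal t :=
  ⟨fun h => (antitone_distr f h).trans (distr_rearr_le f t), fun h => sInf_le h⟩

theorem lt_rearr_iff {t : ℝ} {s : ℝ≥0∞} : s < rearr f t ↔ ENNReal.ofReal t < distr f s := by
  rw [← not_le, rearr_le_iff, not_le]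

theorem distr_rearr (f : ℝ → ℝ≥0∞) (s : ℝ≥0∞) : distr (rearr f) s = distr f s := by
  simp only [distr, lt_rearr_iff, μ_ofReal_lt]

theorem antitone_rearr (f : ℝ → ℝ≥0∞) : Antitone (rearr f) := fun _ _ h =>
  rearr_le_iff.2 ((distr_rearr_le f _).trans (ENNReal.ofReal_le_ofReal h))

theorem lowerSemicontinuous_rearr (f : ℝ → ℝ≥0∞) : LowerSemicontinuous (rearr f) := by
  refine lowerSemicontinuous_iff_isOpen_preimage.2 fun s => ?_
  have : rearr f ⁻¹' Ioi s = {t | ENNReal.ofReal t < distr f s} := by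
    ext t; exact lt_rearr_iff
  rw [this]
  exact isOpen_lt ENNReal.continuous_ofReal continuous_const

theorem measurable_rearr (f : ℝ → ℝ≥0∞) : Measurable (rearr f) := (antitone_rearr f).measurable

theorem rearr_eq_of_distr_eq (h : ∀ s, distr f s = distr g s) : rearr f = rearr g := by
  ext t; simp only [rearr, h]

theorem rearr_congr (h : f =ᵐ[μ] g) : rearr f = rearr g := rearr_eq_of_distr_eq (distr_congr h)

theorem rearr_mono (h : ∀ᵐ x ∂μ, f x ≤ g x) (t : ℝ) : rearr f t ≤ rearr g t :=
  rearr_le_iff.2 ((distr_mono h _).trans (distr_rearr_le g t))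

theorem rearr_eq_zero (h : f =ᵐ[μ] 0) : rearr f = 0 := by
  ext t
  refine le_antisymm (rearr_le_iff.2 ?_) zero_le
  rw [distr_congr h]
  simp [distr]

theorem rearr_const_mul_le (a : ℝ≥0) (f : ℝ → ℝ≥0∞) (t : ℝ) :
    rearr (fun x => a * f x) t ≤ a * rearr f t :=
  rearr_le_iff.2 <| (measure_mono fun x (hx : a * rearr f t < a * f x) =>
    lt_of_mul_lt_mul_left' hx).trans (distr_rearr_le f t)

theorem rearr_iSup {f : ℕ → ℝ → ℝ≥0∞} (hmono : ∀ᵐ x ∂μ, Monotone fun n => f n x) (t : ℝ) :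
    rearr (fun x => ⨆ n, f n x) t = ⨆ n, rearr (f n) t :=
  eq_of_forall_lt_iff fun s => by
    simp only [lt_rearr_iff, distr_iSup hmono, lt_iSup_iff]

theorem rearr_le_of_antitoneOn (hg : AntitoneOn g (Ioi 0)) {t : ℝ} (ht : 0 < t) :
    rearr g t ≤ g t := by
  rw [rearr_le_iff, ← μ_Ioc]
  refine measure_mono_ae (ae_μ_of_forall fun x hx (hlt : g t < g x) => ⟨hx, ?_⟩)
  exact not_lt.1 fun htx => (hg ht hx htx.le).not_gt hlt

theorem rearr_le_of_antitone (hg : Antitone g) {t : ℝ} (ht : 0 ≤ t) : rearr g t ≤ g t := by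
  rcases ht.eq_or_lt with rfl | ht
  · rw [rearr_le_iff]
    exact (measure_eq_zero_iff_ae_notMem.2 (ae_μ_of_forall fun x hx =>
      not_lt.2 (hg hx.le))).trans_le zero_le
  · exact rearr_le_of_antitoneOn (hg.antitoneOn _) ht

theorem lt_top_of_antitoneOn (hg : AntitoneOn g (Ioi 0)) {t : ℝ} (ht : 0 < t)
    (h : ∫⁻ s in Ioc 0 t, g s < ∞) : g t < ∞ := by
  have hmul : g t * ENNReal.ofReal t ≤ ∫⁻ s in Ioc 0 t, g s := by
    rw [← sub_zero t, ← Real.volume_Ioc, sub_zero, ← setLIntegral_const]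
    exact setLIntegral_mono' measurableSet_Ioc fun x hx => hg hx.1 ht hx.2
  by_contra hc
  rw [not_lt_top_iff.1 hc, ENNReal.top_mul (by simpa using ht)] at hmul
  exact (hmul.trans_lt h).false

theorem lintegral_sub_const_eq_of_distr_eq (hf : AEMeasurable f μ) (hg : AEMeasurable g μ)
    (h : ∀ s, distr f s = distr g s) (c : ℝ≥0∞) :
    ∫⁻ x, (f x - c) ∂μ = ∫⁻ x, (g x - c) ∂μ := by
  rw [lintegral_eq_lintegral_meas_ofReal_lt (hf.sub_const c),
    lintegral_eq_lintegral_meas_ofReal_lt (hg.sub_const c)]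
  simp only [lt_tsub_iff_left]
  exact lintegral_congr fun s => h _

theorem lintegral_sub_const_rearr (hf : AEMeasurable f μ) (c : ℝ≥0∞) :
    ∫⁻ x, (rearr f x - c) ∂μ = ∫⁻ x, (f x - c) ∂μ :=
  lintegral_sub_const_eq_of_distr_eq (measurable_rearr f).aemeasurable hf (distr_rearr f) c

theorem lintegral_rearr_le_sub_add (hf : AEMeasurable f μ) (t : ℝ) (c : ℝ≥0∞) :
    ∫⁻ s in Ioc 0 t, rearr f s ≤ ∫⁻ x, (f x - c) ∂μ + c * ENNReal.ofReal t := by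
  rw [← lintegral_sub_const_rearr hf, ← μ_Ioc, ← μ_restrict_Ioc]
  exact setLIntegral_le_lintegral_sub_add _ _ _

theorem lintegral_sub_add_le_lintegral_rearr (hf : AEMeasurable f μ) (t : ℝ) :
    ∫⁻ x, (f x - rearr f t) ∂μ + rearr f t * ENNReal.ofReal t ≤ ∫⁻ s in Ioc 0 t, rearr f s := by
  have htail : ∫⁻ x, (rearr f x - rearr f t) ∂μ ≤ ∫⁻ x in Ioc 0 t, (rearr f x - rearr f t) := by
    rw [← μ_restrict_Ioc, ← lintegral_indicator measurableSet_Ioc]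
    refine lintegral_mono_ae (ae_μ_of_forall fun x hx => ?_)
    by_cases hxt : x ≤ t
    · rw [indicator_of_mem (show x ∈ Ioc 0 t from ⟨hx, hxt⟩)]
    · rw [tsub_eq_zero_of_le (antitone_rearr f (not_le.1 hxt).le)]
      exact zero_le
  calc ∫⁻ x, (f x - rearr f t) ∂μ + rearr f t * ENNReal.ofReal t
      ≤ (∫⁻ x in Ioc 0 t, (rearr f x - rearr f t)) + ∫⁻ _ in Ioc 0 t, rearr f t := by
        rw [← lintegral_sub_const_rearr hf, setLIntegral_const, Real.volume_Ioc, sub_zero]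
        gcongr
    _ = ∫⁻ x in Ioc 0 t, rearr f x := by
        rw [← lintegral_add_right _ measurable_const]
        exact setLIntegral_congr_fun measurableSet_Ioc fun x hx =>
          tsub_add_cancel_of_le (antitone_rearr f hx.2)

theorem lintegral_rearr_add_le (hf : AEMeasurable f μ) (hg : AEMeasurable g μ) (t : ℝ) :
    ∫⁻ s in Ioc 0 t, rearr (fun x => f x + g x) s ≤
      (∫⁻ s in Ioc 0 t, rearr f s) + ∫⁻ s in Ioc 0 t, rearr g s := by
  refine le_trans ?_ (add_le_add (lintegral_sub_add_le_lintegral_rearr hf t)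
    (lintegral_sub_add_le_lintegral_rearr hg t))
  refine (lintegral_rearr_le_sub_add (hf.add hg) t (rearr f t + rearr g t)).trans ?_
  rw [add_mul, add_add_add_comm, ← lintegral_add_left' (hf.sub_const _)]
  gcongr
  exact add_tsub_add_le_tsub_add_tsub

theorem setLIntegral_le_lintegral_rearr (hf : AEMeasurable f μ) {E : Set ℝ} {t : ℝ}
    (hE : μ E ≤ ENNReal.ofReal t) : ∫⁻ x in E, f x ∂μ ≤ ∫⁻ s in Ioc 0 t, rearr f s :=
  calc ∫⁻ x in E, f x ∂μ ≤ ∫⁻ x, (f x - rearr f t) ∂μ + rearr f t * μ E :=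
        setLIntegral_le_lintegral_sub_add _ _ _
    _ ≤ _ := by grw [hE, lintegral_sub_add_le_lintegral_rearr hf t]

theorem ae_lt_top_of_lintegral_rearr_lt_top (hf : AEMeasurable f μ) {t : ℝ} (ht : 0 < t)
    (h : ∫⁻ s in Ioc 0 t, rearr f s < ∞) : ∀ᵐ x ∂μ, f x < ∞ := by
  have hc := lt_top_of_antitoneOn ((antitone_rearr f).antitoneOn _) ht h
  have hsub := le_self_add.trans (lintegral_sub_add_le_lintegral_rearr hf t)
  filter_upwards [ae_lt_top' (hf.sub_const _) (hsub.trans_lt h).ne] with x hx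
  by_contra htop
  rw [not_lt_top_iff.1 htop, ENNReal.top_sub hc.ne] at hx
  exact hx.false

theorem ae_eq_zero_of_lintegral_rearr_eq_zero
    (h : ∀ t, 0 < t → ∫⁻ s in Ioc 0 t, rearr f s = 0) : f =ᵐ[μ] 0 := by
  have hdistr : distr f 0 = 0 := by
    by_contra hne
    obtain ⟨t, -, ht, htd⟩ := ENNReal.lt_iff_exists_real_btwn.1 (pos_iff_ne_zero.2 hne)
    have ht₀ : 0 < t := by simpa using ht
    have hle : rearr f t * ENNReal.ofReal t ≤ 0 := by
      rw [← h t ht₀, ← sub_zero t, ← Real.volume_Ioc, sub_zero, ← setLIntegral_const]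
      exact setLIntegral_mono (measurable_rearr f) fun x hx => antitone_rearr f hx.2
    exact (mul_ne_zero (lt_rearr_iff.2 htd).ne' ht.ne') (nonpos_iff_eq_zero.1 hle)
  filter_upwards [measure_eq_zero_iff_ae_notMem.1 hdistr] with x hx
  exact nonpos_iff_eq_zero.1 (not_lt.1 hx)

theorem tendsto_lintegral_Ioc_zero {G : ℝ → ℝ≥0∞} (h : ∫⁻ s in Ioc 0 1, G s ≠ ∞) :
    Tendsto (fun t => ∫⁻ s in Ioc 0 t, G s) (𝓝[>] 0) (𝓝 0) := by
  have hvol : Tendsto (fun t : ℝ => volume.restrict (Ioc 0 1) (Ioc 0 t)) (𝓝[>] 0) (𝓝 0) := by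
    refine tendsto_of_tendsto_of_tendsto_of_le_of_le tendsto_const_nhds
      (h := fun t : ℝ => ENNReal.ofReal t) ?_ (fun _ => zero_le) fun t =>
        (Measure.restrict_apply_le _ _).trans (by simp)
    simpa using (ENNReal.continuous_ofReal.tendsto 0).mono_left nhdsWithin_le_nhds
  refine (tendsto_setLIntegral_zero h hvol).congr' ?_
  filter_upwards [Ioo_mem_nhdsGT one_pos] with t ht
  rw [Measure.restrict_restrict measurableSet_Ioc,
    inter_eq_left.2 (Ioc_subset_Ioc_right ht.2.le)]

theorem exists_le_ofReal {a : ℝ≥0∞} (ha : a ≠ ∞) : ∃ T : ℝ, 0 < T ∧ a ≤ ENNReal.ofReal T :=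
  ⟨a.toReal + 1, by positivity, ENNReal.le_ofReal_iff_toReal_le ha (by positivity) |>.2 (by simp)⟩

theorem rearr_indicator_le {E : Set ℝ} {T : ℝ} (hE : μ E ≤ ENNReal.ofReal T) (t : ℝ) :
    rearr (E.indicator fun _ => 1) t ≤ (Iio T).indicator 1 t := by
  rw [rearr_le_iff]
  rcases lt_or_ge t T with h | h
  · rw [indicator_of_mem (mem_Iio.2 h)]
    refine (measure_eq_zero_iff_ae_notMem.2 (.of_forall fun x => ?_)).trans_le zero_le
    exact not_lt.2 (indicator_le_self E (fun _ => (1 : ℝ≥0∞)) x)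
  · rw [indicator_of_notMem (by simpa using h)]
    refine (measure_mono fun x hx => ?_).trans (hE.trans (ENNReal.ofReal_le_ofReal h))
    exact mem_of_indicator_ne_zero
      (ne_of_gt (show 0 < E.indicator (fun _ => (1 : ℝ≥0∞)) x from hx))

theorem maxRearr_le_iff {t : ℝ} (ht : 0 < t) :
    maxRearr f t ≤ maxRearr g t ↔
      ∫⁻ s in Ioc 0 t, rearr f s ≤ ∫⁻ s in Ioc 0 t, rearr g s :=
  ENNReal.mul_le_mul_iff_right (by simp) (by simpa using ht)

theorem abs_sub_max_neg_min {c : ℝ} (hc : 0 ≤ c) (x : ℝ) :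
    |x - max (-c) (min x c)| = max (|x| - c) 0 := by
  grind

theorem mem_L1AddLinfty {f : ℝ → ℝ} (hf : AEMeasurable f μ)
    (h : ∫⁻ s in Ioc 0 1, rearr (absFun f) s < ∞) : f ∈ L1AddLinfty := by
  have hfin := lt_top_of_antitoneOn ((antitone_rearr (absFun f)).antitoneOn _) one_pos h
  obtain ⟨c, hc⟩ := ENNReal.lt_iff_exists_coe.1 hfin
  set b : ℝ → ℝ := fun x => max (-c) (min (f x) c)
  have hbm : AEMeasurable b μ := aemeasurable_const.max (hf.min aemeasurable_const)
  refine ⟨fun x => f x - b x, b, ⟨(hf.sub hbm).aestronglyMeasurable, ?_⟩, ?_,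
    .of_forall fun x => (sub_add_cancel (f x) (b x)).symm⟩
  · have hsub : ∀ x, ‖f x - b x‖ₑ = absFun f x - rearr (absFun f) 1 := fun x => by
      rw [hc.1, absFun, Real.enorm_eq_ofReal_abs, Real.enorm_eq_ofReal_abs,
        abs_sub_max_neg_min c.coe_nonneg, ENNReal.ofReal_max, ENNReal.ofReal_zero,
        max_eq_left zero_le, ENNReal.ofReal_sub _ c.coe_nonneg, ENNReal.ofReal_coe_nnreal]
    simp only [eLpNorm_one_eq_lintegral_enorm, hsub]
    exact (le_self_add.trans (lintegral_sub_add_le_lintegral_rearr hf.enorm 1)).trans_lt h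
  · refine memLp_top_of_bound hbm.aestronglyMeasurable c (.of_forall fun x => ?_)
    exact abs_le.2 ⟨le_max_left _ _, max_le (by simp) (min_le_right _ _)⟩

end Distribution

/-- Right-continuous decreasing functions with values in `[0, ∞]`; for a decreasing function,
right-continuity is the same as lower semicontinuity. -/
structure IsDecreasing (G : ℝ → ℝ≥0∞) : Prop where
  antitone : Antitone G
  lowerSemicontinuous : LowerSemicontinuous G

theorem isDecreasing_rearr (f : ℝ → ℝ≥0∞) : IsDecreasing (rearr f) :=
  ⟨antitone_rearr f, lowerSemicontinuous_rearr f⟩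

theorem isDecreasing_zero : IsDecreasing 0 := ⟨fun _ _ _ => le_rfl, lowerSemicontinuous_const⟩

theorem isDecreasing_indicator_Iio (d : ℝ) : IsDecreasing ((Iio d).indicator 1) :=
  ⟨fun x y h => by
      by_cases hy : y < d
      · simp [indicator, hy, h.trans_lt hy]
      · simp [indicator, hy],
    isOpen_Iio.lowerSemicontinuous_indicator zero_le⟩

theorem measure_le_mul_of_isLowerSet {ν₁ ν₂ : Measure ℝ} {C : ℝ≥0∞} {U : Set ℝ} (hU : IsOpen U)
    (hlow : IsLowerSet U) (h : ∀ d ∈ U, ν₁ (Iio d) ≤ C * ν₂ (Iio d)) : ν₁ U ≤ C * ν₂ U := by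
  have hunion : U = ⋃ q ∈ {q : ℚ | (q : ℝ) ∈ U}, Iio (q : ℝ) := by
    ext x
    simp only [mem_iUnion, mem_Iio, exists_prop]
    refine ⟨fun hx => ?_, fun ⟨q, hq, hxq⟩ => hlow hxq.le hq⟩
    obtain ⟨y, hxy, hy⟩ := mem_nhdsGE_iff_exists_Ico_subset.1
      (mem_nhdsWithin_of_mem_nhds (hU.mem_nhds hx))
    obtain ⟨q, hxq, hqy⟩ := exists_rat_btwn (mem_Ioi.1 hxy)
    exact ⟨q, hy ⟨hxq.le, hqy⟩, hxq⟩
  have hdir : DirectedOn (Function.onFun (· ⊆ ·) fun q : ℚ => Iio (q : ℝ))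
      {q : ℚ | (q : ℝ) ∈ U} := fun a ha b hb => (le_total a b).elim
    (fun h => ⟨b, hb, Iio_subset_Iio (by exact_mod_cast h), subset_rfl⟩)
    (fun h => ⟨a, ha, subset_rfl, Iio_subset_Iio (by exact_mod_cast h)⟩)
  nth_rewrite 1 [hunion]
  rw [measure_biUnion_eq_iSup (to_countable _) hdir]
  exact iSup₂_le fun q hq => (h q hq).trans (by gcongr; exact fun x hx => hlow (le_of_lt hx) hq)

namespace IsDecreasing

variable {G K : ℝ → ℝ≥0∞}

theorem measurable (hG : IsDecreasing G) : Measurable G := hG.antitone.measurable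

theorem add (hG : IsDecreasing G) (hK : IsDecreasing K) : IsDecreasing (G + K) :=
  ⟨hG.antitone.add hK.antitone, hG.lowerSemicontinuous.add hK.lowerSemicontinuous⟩

theorem const_mul (hG : IsDecreasing G) {c : ℝ≥0∞} (hc : c ≠ ∞) :
    IsDecreasing fun x => c * G x :=
  ⟨fun _ _ h => mul_le_mul_right (hG.antitone h) _,
    (ENNReal.continuous_const_mul hc).comp_lowerSemicontinuous hG.lowerSemicontinuous
      fun _ _ h => mul_le_mul_right h _⟩

theorem sub_const (hG : IsDecreasing G) (c : ℝ≥0∞) : IsDecreasing fun x => G x - c := by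
  refine ⟨fun _ _ h => tsub_le_tsub_right (hG.antitone h) _,
    lowerSemicontinuous_iff_isOpen_preimage.2 fun s => ?_⟩
  have : (fun x => G x - c) ⁻¹' Ioi s = G ⁻¹' Ioi (c + s) := by
    ext x; simp [lt_tsub_iff_left]
  rw [this]
  exact hG.lowerSemicontinuous.isOpen_preimage _

theorem tsum {G : ℕ → ℝ → ℝ≥0∞} (hG : ∀ n, IsDecreasing (G n)) :
    IsDecreasing fun x => ∑' n, G n x :=
  ⟨fun _ _ h => ENNReal.tsum_le_tsum fun n => (hG n).antitone h,
    lowerSemicontinuous_tsum fun n => (hG n).lowerSemicontinuous⟩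

theorem lintegral_le_mul (hG : IsDecreasing G) {ν₁ ν₂ : Measure ℝ} {C : ℝ≥0∞}
    (h₀ : ν₁ (Iio 0) = 0) (h : ∀ d, 0 < d → G d ≠ 0 → ν₁ (Iio d) ≤ C * ν₂ (Iio d)) :
    ∫⁻ x, G x ∂ν₁ ≤ C * ∫⁻ x, G x ∂ν₂ := by
  rw [lintegral_eq_lintegral_meas_ofReal_lt hG.measurable.aemeasurable,
    lintegral_eq_lintegral_meas_ofReal_lt hG.measurable.aemeasurable, ← lintegral_const_mul]
  · refine lintegral_mono fun s => measure_le_mul_of_isLowerSet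
      (hG.lowerSemicontinuous.isOpen_preimage _)
      (fun x y hxy hx => lt_of_lt_of_le hx (hG.antitone hxy)) fun d hd => ?_
    rcases le_or_gt d 0 with hd₀ | hd₀
    · exact (measure_mono (Iio_subset_Iio hd₀)).trans (h₀.le.trans zero_le)
    · exact h d hd₀ (ne_zero_of_lt hd)
  · exact Antitone.measurable fun a b hab => measure_mono fun x hx =>
      lt_of_le_of_lt (ENNReal.ofReal_le_ofReal hab) hx

end IsDecreasing

theorem lintegral_Ioc_add (F : ℝ → ℝ≥0∞) {a b c : ℝ} (hab : a ≤ b) (hbc : b ≤ c) :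
    (∫⁻ s in Ioc a b, F s) + ∫⁻ s in Ioc b c, F s = ∫⁻ s in Ioc a c, F s := by
  rw [← Ioc_union_Ioc_eq_Ioc hab hbc, lintegral_union measurableSet_Ioc
    (Ioc_disjoint_Ioc_of_le le_rfl)]

/-- The average `t⁻¹ ∫₀ᵗ G` of a nonnegative function. -/
noncomputable def avg (G : ℝ → ℝ≥0∞) (t : ℝ) : ℝ≥0∞ :=
  (ENNReal.ofReal t)⁻¹ * ∫⁻ r in Ioc 0 t, G r

section Avg

variable {G : ℝ → ℝ≥0∞}

theorem ofReal_mul_avg {t : ℝ} (ht : 0 < t) :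
    ENNReal.ofReal t * avg G t = ∫⁻ r in Ioc 0 t, G r := by
  rw [avg, ← mul_assoc, ENNReal.mul_inv_cancel (by simpa using ht) (by simp), one_mul]

theorem measurable_avg : Measurable (avg G) :=
  ENNReal.measurable_ofReal.inv.mul
    (Monotone.measurable fun _ _ h => lintegral_mono_set (Ioc_subset_Ioc_right h))

theorem le_avg (hG : Antitone G) {t : ℝ} (ht : 0 < t) : G t ≤ avg G t := by
  rw [avg, ← ENNReal.div_eq_inv_mul, ENNReal.le_div_iff_mul_le (by simp [ht]) (by simp),
    ← sub_zero t, ← Real.volume_Ioc, sub_zero, ← setLIntegral_const]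
  exact setLIntegral_mono hG.measurable fun x hx => hG hx.2

theorem antitoneOn_avg (hG : Antitone G) : AntitoneOn (avg G) (Ioi 0) := by
  intro a (ha : 0 < a) b _ hab
  have htail : ∫⁻ r in Ioc a b, G r ≤ ENNReal.ofReal (b - a) * avg G a := by
    rw [← Real.volume_Ioc, mul_comm, ← setLIntegral_const]
    exact setLIntegral_mono measurable_const fun x hx => (hG hx.1.le).trans (le_avg hG ha)
  rw [avg, ← ENNReal.div_eq_inv_mul]
  refine ENNReal.div_le_of_le_mul' ?_
  calc ∫⁻ r in Ioc 0 b, G r = (∫⁻ r in Ioc 0 a, G r) + ∫⁻ r in Ioc a b, G r :=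
        (lintegral_Ioc_add G ha.le hab).symm
    _ ≤ ENNReal.ofReal a * avg G a + ENNReal.ofReal (b - a) * avg G a := by
        rw [ofReal_mul_avg ha]
        gcongr
    _ = ENNReal.ofReal b * avg G a := by
        rw [← add_mul, ← ENNReal.ofReal_add ha.le (sub_nonneg.2 hab), add_sub_cancel]

end Avg

theorem restrict_Ioc_Iio (t d : ℝ) :
    volume.restrict (Ioc 0 t) (Iio d) = ENNReal.ofReal (min d t) := by
  rw [measure_congr Iio_ae_eq_Iic, Measure.restrict_apply measurableSet_Iic, inter_comm,
    Ioc_inter_Iic, Real.volume_Ioc, sub_zero, min_comm]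

/-- The measure with `∫ G d(avgMeasure t) = ∫₀ᵗ (s⁻¹ ∫₀ˢ G) ds`. It is `log (t / r) dr` on
`(0, t]`, but only this disintegration is used. -/
noncomputable def avgMeasure (t : ℝ) : Measure ℝ :=
  (volume.restrict (Ioc 0 t)).bind fun s => (ENNReal.ofReal s)⁻¹ • volume.restrict (Ioc 0 s)

theorem measurable_inv_smul_restrict_Ioc :
    Measurable fun s : ℝ => (ENNReal.ofReal s)⁻¹ • volume.restrict (Ioc 0 s) := by
  refine Measure.measurable_of_measurable_coe _ fun A hA => ?_
  simp only [Measure.smul_apply, Measure.restrict_apply hA, smul_eq_mul]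
  exact ENNReal.measurable_ofReal.inv.mul
    (Monotone.measurable fun _ _ h => measure_mono (inter_subset_inter_right _
      (Ioc_subset_Ioc_right h)))

theorem lintegral_avgMeasure {G : ℝ → ℝ≥0∞} (hG : Measurable G) (t : ℝ) :
    ∫⁻ x, G x ∂avgMeasure t = ∫⁻ s in Ioc 0 t, avg G s := by
  rw [avgMeasure, Measure.lintegral_bind measurable_inv_smul_restrict_Ioc.aemeasurable
    hG.aemeasurable]
  simp only [lintegral_smul_measure, avg, smul_eq_mul]

theorem avgMeasure_apply {A : Set ℝ} (hA : MeasurableSet A) (t : ℝ) :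
    avgMeasure t A = ∫⁻ s in Ioc 0 t, (ENNReal.ofReal s)⁻¹ * volume (A ∩ Ioc 0 s) := by
  rw [avgMeasure, Measure.bind_apply hA measurable_inv_smul_restrict_Ioc.aemeasurable]
  simp only [Measure.smul_apply, Measure.restrict_apply hA, smul_eq_mul]

theorem avgMeasure_absolutelyContinuous (t : ℝ) : avgMeasure t ≪ μ := by
  refine Measure.AbsolutelyContinuous.mk fun A hA h => ?_
  rw [μ, Measure.restrict_apply hA] at h
  rw [avgMeasure_apply hA]
  simp [measure_mono_null (inter_subset_inter_right A Ioc_subset_Ioi_self) h]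

theorem avgMeasure_mono : Monotone avgMeasure := fun _ _ h =>
  Measure.le_iff.2 fun A hA => by
    rw [avgMeasure_apply hA, avgMeasure_apply hA]
    exact lintegral_mono_set (Ioc_subset_Ioc_right h)

theorem avgMeasure_Iio (t d : ℝ) :
    avgMeasure t (Iio d) = ∫⁻ s in Ioc 0 t, ENNReal.ofReal (min d s / s) := by
  rw [avgMeasure_apply measurableSet_Iio]
  refine setLIntegral_congr_fun measurableSet_Ioc fun s hs => ?_
  rw [← Measure.restrict_apply measurableSet_Iio, restrict_Ioc_Iio,
    ENNReal.ofReal_div_of_pos hs.1, ENNReal.div_eq_inv_mul]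

theorem avgMeasure_Iio_zero (t : ℝ) : avgMeasure t (Iio 0) = 0 := by
  rw [avgMeasure_Iio]
  refine setLIntegral_eq_zero measurableSet_Ioc fun s hs => ?_
  simp [hs.1.le]

theorem avgMeasure_Iio_of_le {t d : ℝ} (h : t ≤ d) : avgMeasure t (Iio d) = ENNReal.ofReal t := by
  rw [avgMeasure_Iio, setLIntegral_congr_fun (g := 1) measurableSet_Ioc fun s hs => by
    simp [hs.2.trans h, hs.1.ne']]
  simp

theorem avgMeasure_univ (t : ℝ) : avgMeasure t univ = ENNReal.ofReal t := by
  rw [← iUnion_Iio, Monotone.measure_iUnion fun _ _ h => Iio_subset_Iio h]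
  refine le_antisymm (iSup_le fun d => ?_) (le_iSup_of_le t (avgMeasure_Iio_of_le le_rfl).ge)
  rw [← avgMeasure_Iio_of_le (le_max_right d t)]
  exact measure_mono (Iio_subset_Iio (le_max_left d t))

instance isFiniteMeasure_avgMeasure (t : ℝ) : IsFiniteMeasure (avgMeasure t) :=
  ⟨by simp [avgMeasure_univ]⟩

theorem avgMeasure_Iio_of_ge {t d : ℝ} (hd : 0 < d) (h : d ≤ t) :
    avgMeasure t (Iio d) = ENNReal.ofReal (d * (1 + Real.log (t / d))) := by
  have hint : IntervalIntegrable (fun s : ℝ => d * s⁻¹) volume d t := by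
    refine ContinuousOn.intervalIntegrable (continuousOn_const.mul (continuousOn_inv₀.mono ?_))
    exact fun x hx => (hd.trans_le (uIcc_of_le h ▸ hx).1).ne'
  have htail : ∫⁻ s in Ioc d t, ENNReal.ofReal (min d s / s) =
      ENNReal.ofReal (d * Real.log (t / d)) := by
    rw [setLIntegral_congr_fun (g := fun s => ENNReal.ofReal (d * s⁻¹)) measurableSet_Ioc
        fun s hs => by simp [min_eq_left hs.1.le, div_eq_mul_inv],
      ← ofReal_integral_eq_lintegral_ofReal
        ((intervalIntegrable_iff_integrableOn_Ioc_of_le h).1 hint),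
      ← intervalIntegral.integral_of_le h, intervalIntegral.integral_const_mul,
      integral_inv_of_pos hd (hd.trans_le h)]
    exact (ae_restrict_iff' measurableSet_Ioc).2 (.of_forall fun s hs =>
      mul_nonneg hd.le (inv_nonneg.2 (hd.trans hs.1).le))
  rw [avgMeasure_Iio, ← lintegral_Ioc_add _ hd.le h, htail, ← avgMeasure_Iio,
    avgMeasure_Iio_of_le le_rfl, ← ENNReal.ofReal_add hd.le
      (mul_nonneg hd.le (Real.log_nonneg ((one_le_div hd).2 h))),
    mul_add, mul_one]

namespace QuasiConcave

variable {φ : ℝ → ℝ} (hφ : QuasiConcave φ) {G : ℝ → ℝ≥0∞}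

include hφ in
theorem mul_min_one_div_le {t d : ℝ} (ht : 0 < t) (hd : 0 < d) : φ t * min 1 (d / t) ≤ φ d := by
  rcases le_total d t with h | h
  · rw [min_eq_right ((div_le_one ht).2 h), mul_div_left_comm, mul_comm]
    exact (le_div_iff₀ hd).1 (hφ.anti hd ht h)
  · rw [min_eq_left ((one_le_div ht).2 h), mul_one]
    exact hφ.mono ht hd h

include hφ in
theorem continuousAt {d : ℝ} (hd : 0 < d) : ContinuousAt φ d := by
  have hlow : Tendsto (fun x => φ d * min 1 (x / d)) (𝓝 d) (𝓝 (φ d)) := by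
    have : ContinuousAt (fun x => φ d * min 1 (x / d)) d := by fun_prop
    simpa [ContinuousAt, hd.ne'] using this
  have hupp : Tendsto (fun x => φ d / min 1 (d / x)) (𝓝 d) (𝓝 (φ d)) := by
    have : ContinuousAt (fun x => φ d / min 1 (d / x)) d := by
      fun_prop (disch := simp [hd.ne'])
    simpa [ContinuousAt, hd.ne'] using this
  refine tendsto_of_tendsto_of_tendsto_of_le_of_le' hlow hupp ?_ ?_
  · filter_upwards [lt_mem_nhds hd] with x hx
    exact hφ.mul_min_one_div_le hd hx
  · filter_upwards [lt_mem_nhds hd] with x hx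
    rw [le_div_iff₀ (by positivity)]
    exact hφ.mul_min_one_div_le hx hd

include hφ in
theorem continuousAt_extendZero {x : ℝ} (hx : x ≠ 0) : ContinuousAt (extendZero φ) x := by
  rcases lt_or_gt_of_ne hx with h | h
  · refine (continuousAt_const (y := (0 : ℝ))).congr ?_
    filter_upwards [gt_mem_nhds h] with y hy
    simp [extendZero, hy.le]
  · refine (hφ.continuousAt h).congr ?_
    filter_upwards [lt_mem_nhds h] with y hy
    simp [extendZero, hy]

theorem stieltjesFunction_apply {x : ℝ} (hx : x ≠ 0) :
    hφ.monotone_extendZero.stieltjesFunction x = extendZero φ x := by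
  rw [Monotone.stieltjesFunction_eq]
  exact rightLim_eq_of_tendsto ((hφ.continuousAt_extendZero hx).mono_left nhdsWithin_le_nhds)

theorem dφ_Iio_of_tendsto {l d : ℝ} (h : Tendsto (extendZero φ) (𝓝[<] d) (𝓝 l)) :
    hφ.dφ (Iio d) = ENNReal.ofReal l := by
  have hbot : Tendsto hφ.monotone_extendZero.stieltjesFunction atBot (𝓝 0) := by
    refine tendsto_const_nhds.congr' ?_
    filter_upwards [eventually_lt_atBot 0] with x hx
    rw [hφ.stieltjesFunction_apply hx.ne]
    simp [extendZero, hx.le]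
  have hleft : Tendsto hφ.monotone_extendZero.stieltjesFunction (𝓝[<] d) (𝓝 l) := by
    refine h.congr' ?_
    have : ∀ᶠ x in 𝓝[<] d, x ≠ 0 := by
      rcases eq_or_ne d 0 with rfl | hd
      · filter_upwards [self_mem_nhdsWithin] with x hx using ne_of_lt hx
      · exact nhdsWithin_le_nhds (isOpen_ne.mem_nhds hd)
    filter_upwards [this] with x hx using (hφ.stieltjesFunction_apply hx).symm
  rw [dφ, StieltjesFunction.measure_Iio _ hbot, sub_zero, leftLim_eq_of_tendsto hleft]

theorem dφ_Iio {d : ℝ} (hd : 0 < d) : hφ.dφ (Iio d) = ENNReal.ofReal (φ d) := by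
  rw [hφ.dφ_Iio_of_tendsto ((hφ.continuousAt_extendZero hd.ne').mono_left nhdsWithin_le_nhds)]
  simp [extendZero, hd]

theorem dφ_Iio_zero : hφ.dφ (Iio 0) = 0 := by
  rw [hφ.dφ_Iio_of_tendsto (l := 0), ENNReal.ofReal_zero]
  refine tendsto_const_nhds.congr' ?_
  filter_upwards [self_mem_nhdsWithin] with x hx
  simp [extendZero, (show x < 0 from hx).le]

theorem ae_dφ_of_forall {p : ℝ → Prop} (h : ∀ x, 0 ≤ x → p x) : ∀ᵐ x ∂hφ.dφ, p x :=
  (measure_eq_zero_iff_ae_notMem.1 hφ.dφ_Iio_zero).mono fun x hx => h x (not_lt.1 hx)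

theorem mul_dφ_Iio_le (hG : Antitone G) (t : ℝ) : G t * hφ.dφ (Iio t) ≤ ∫⁻ x, G x ∂hφ.dφ := by
  rw [← setLIntegral_const]
  exact (setLIntegral_mono hG.measurable fun x hx => hG (le_of_lt hx)).trans
    (setLIntegral_le_lintegral _ _)

theorem dφ_Iio_ne_zero {d : ℝ} (hd : 0 < d) : hφ.dφ (Iio d) ≠ 0 := by
  simpa [hφ.dφ_Iio hd] using hφ.pos d hd

theorem dφ_Iio_ne_top {d : ℝ} (hd : 0 < d) : hφ.dφ (Iio d) ≠ ∞ := by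
  simp [hφ.dφ_Iio hd]

theorem lt_top_of_lintegral_lt_top (hG : Antitone G) (h : ∫⁻ x, G x ∂hφ.dφ < ∞) {t : ℝ}
    (ht : 0 < t) : G t < ∞ :=
  ENNReal.lt_top_of_mul_ne_top_left ((hφ.mul_dφ_Iio_le hG t).trans_lt h).ne (hφ.dφ_Iio_ne_zero ht)

theorem lintegral_Ioc_le (hG : IsDecreasing G) {t : ℝ} (ht : 0 < t) :
    ∫⁻ r in Ioc 0 t, G r ≤ ENNReal.ofReal (t / φ t) * ∫⁻ x, G x ∂hφ.dφ := by
  have hp := hφ.pos t ht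
  refine hG.lintegral_le_mul (by rw [restrict_Ioc_Iio]; simp [ht.le]) fun d hd _ => ?_
  rw [restrict_Ioc_Iio, hφ.dφ_Iio hd, ← ENNReal.ofReal_mul (by positivity)]
  refine ENNReal.ofReal_le_ofReal ?_
  calc min d t = t / φ t * (φ t * min 1 (d / t)) := by
        rw [min_comm, ← mul_assoc, div_mul_cancel₀ _ hp.ne', mul_min_of_nonneg _ _ ht.le, mul_one,
          mul_div_cancel₀ _ ht.ne']
    _ ≤ t / φ t * φ d := by gcongr; exact hφ.mul_min_one_div_le ht hd

theorem lintegral_Ioc_lt_top (hG : IsDecreasing G) (h : ∫⁻ x, G x ∂hφ.dφ < ∞) {t : ℝ}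
    (ht : 0 < t) : ∫⁻ r in Ioc 0 t, G r < ∞ :=
  (hφ.lintegral_Ioc_le hG ht).trans_lt (ENNReal.mul_lt_top ENNReal.ofReal_lt_top h)

end QuasiConcave

theorem avgMeasure_Iio_le_add {s d : ℝ} (hs : 0 < s) (hd : 0 < d) (t : ℝ) :
    avgMeasure t (Iio d) ≤ avgMeasure s (Iio d) + ENNReal.ofReal (d * ((t - s) / s)) := by
  rcases le_total t s with h | h
  · exact (avgMeasure_mono h _).trans le_self_add
  · rw [avgMeasure_Iio, avgMeasure_Iio, ← lintegral_Ioc_add _ hs.le h]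
    gcongr
    calc ∫⁻ x in Ioc s t, ENNReal.ofReal (min d x / x)
        ≤ ∫⁻ _ in Ioc s t, ENNReal.ofReal (d / s) :=
          setLIntegral_mono measurable_const fun x hx => ENNReal.ofReal_le_ofReal <|
            div_le_div₀ hd.le (min_le_left _ _) hs hx.1.le
      _ = ENNReal.ofReal (d * ((t - s) / s)) := by
          rw [setLIntegral_const, Real.volume_Ioc, ← ENNReal.ofReal_mul (by positivity),
            div_mul_eq_mul_div, mul_div_assoc]

/-- The growth condition of the theorem. -/
def Growth (φ : ℝ → ℝ) : Prop :=
  ∃ C : ℝ, 0 < C ∧ ∀ t : ℝ, 0 < t → C * (t * Real.log (1 + 1 / t)) ≤ φ t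

theorem one_add_log_div_le {t d : ℝ} (ht : 0 < t) (hd : 0 < d) (h : d ≤ t) :
    1 + Real.log (t / d) ≤
      ((1 + |Real.log t|) / Real.log (1 + 1 / t) + 1) * Real.log (1 + 1 / d) := by
  have hpos : 0 < Real.log (1 + 1 / t) := Real.log_pos (by simpa using ht)
  have hmono : Real.log (1 + 1 / t) ≤ Real.log (1 + 1 / d) :=
    Real.log_le_log (by positivity) (by gcongr)
  have hlog : Real.log (1 / d) ≤ Real.log (1 + 1 / d) :=
    Real.log_le_log (by positivity) (by linarith)
  have habs : 1 + |Real.log t| ≤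
      (1 + |Real.log t|) / Real.log (1 + 1 / t) * Real.log (1 + 1 / d) := by
    rw [div_mul_eq_mul_div, le_div_iff₀ hpos]
    gcongr
  rw [div_eq_mul_one_div, Real.log_mul ht.ne' (by positivity)]
  linarith [le_abs_self (Real.log t)]

namespace QuasiConcave

variable {φ : ℝ → ℝ} (hφ : QuasiConcave φ)

theorem exists_avgMeasure_Iio_le (hgr : Growth φ) {t : ℝ} (ht : 0 < t) :
    ∃ C : ℝ≥0, ∀ d, 0 < d → avgMeasure t (Iio d) ≤ C * hφ.dφ (Iio d) := by
  obtain ⟨C, hC, hgr⟩ := hgr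
  have hp := hφ.pos t ht
  set A := (1 + |Real.log t|) / Real.log (1 + 1 / t) + 1
  have : 0 ≤ A := by
    have : 0 < Real.log (1 + 1 / t) := Real.log_pos (by simpa using ht)
    positivity
  refine ⟨(max (A / C) (t / φ t)).toNNReal, fun d hd => ?_⟩
  rw [hφ.dφ_Iio hd, ← ENNReal.ofReal,
    ← ENNReal.ofReal_mul (le_max_of_le_right (div_pos ht hp).le)]
  rcases le_total d t with h | h
  · rw [avgMeasure_Iio_of_ge hd h]
    refine ENNReal.ofReal_le_ofReal ?_
    calc d * (1 + Real.log (t / d)) ≤ d * (A * Real.log (1 + 1 / d)) := by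
          gcongr; exact one_add_log_div_le ht hd h
      _ = A / C * (C * (d * Real.log (1 + 1 / d))) := by field_simp
      _ ≤ max (A / C) (t / φ t) * φ d :=
        mul_le_mul (le_max_left _ _) (hgr d hd)
          (mul_nonneg hC.le (mul_nonneg hd.le (Real.log_nonneg (by simp [hd.le])))) (by positivity)
  · rw [avgMeasure_Iio_of_le h]
    refine ENNReal.ofReal_le_ofReal ?_
    calc t = t / φ t * φ t := by field_simp
      _ ≤ max (A / C) (t / φ t) * φ d := by
        gcongr
        exacts [le_max_right _ _, hφ.mono ht hd h]

theorem exists_lintegral_avgMeasure_le (hgr : Growth φ) {t : ℝ} (ht : 0 < t) :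
    ∃ C : ℝ≥0, ∀ G, IsDecreasing G → ∫⁻ x, G x ∂avgMeasure t ≤ C * ∫⁻ x, G x ∂hφ.dφ := by
  obtain ⟨C, hC⟩ := hφ.exists_avgMeasure_Iio_le hgr ht
  exact ⟨C, fun G hG => hG.lintegral_le_mul (avgMeasure_Iio_zero t) fun d hd _ => hC d hd⟩

theorem lintegral_avgMeasure_lt_top (hgr : Growth φ) {G : ℝ → ℝ≥0∞} (hG : IsDecreasing G)
    (h : ∫⁻ x, G x ∂hφ.dφ < ∞) {t : ℝ} (ht : 0 < t) : ∫⁻ x, G x ∂avgMeasure t < ∞ := by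
  obtain ⟨C, hC⟩ := hφ.exists_lintegral_avgMeasure_le hgr ht
  exact (hC G hG).trans_lt (ENNReal.mul_lt_top ENNReal.coe_lt_top h)

/-- The critical constant of `φ`: the upper limit at `0` of `d (1 + log (1 / d)) / φ d`, which is
the largest possible loss of `∫ G d(avgMeasure t)` per unit of Lorentz norm escaping to `0`. -/
noncomputable def critConst : ℝ≥0∞ :=
  limsup (fun d => avgMeasure 1 (Iio d) / hφ.dφ (Iio d)) (𝓝[>] 0)

theorem critConst_ne_top (hgr : Growth φ) : hφ.critConst ≠ ∞ := by
  obtain ⟨C, hC⟩ := hφ.exists_avgMeasure_Iio_le hgr one_pos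
  refine ne_top_of_le_ne_top ENNReal.coe_ne_top
    (limsup_le_of_le (a := (C : ℝ≥0∞)) (by isBoundedDefault) ?_)
  filter_upwards [self_mem_nhdsWithin] with d hd
  exact ENNReal.div_le_of_le_mul (hC d hd)

theorem tendsto_ofReal_div_dφ_Iio (hgr : Growth φ) :
    Tendsto (fun d => ENNReal.ofReal d / hφ.dφ (Iio d)) (𝓝[>] 0) (𝓝 0) := by
  obtain ⟨C, hC⟩ := hφ.exists_avgMeasure_Iio_le hgr one_pos
  have hlog : Tendsto (fun d : ℝ => 1 + Real.log (1 / d)) (𝓝[>] 0) atTop := by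
    refine tendsto_atTop_add_const_left _ _ (Real.tendsto_log_atTop.comp ?_)
    exact (tendsto_inv_nhdsGT_zero (𝕜 := ℝ)).congr fun x => (one_div x).symm
  have hbound : Tendsto (fun d : ℝ => C / ENNReal.ofReal (1 + Real.log (1 / d))) (𝓝[>] 0)
      (𝓝 0) := by
    simpa using ENNReal.Tendsto.const_div (ENNReal.tendsto_ofReal_atTop.comp hlog)
      (.inr ENNReal.coe_ne_top)
  refine tendsto_of_tendsto_of_tendsto_of_le_of_le' tendsto_const_nhds hbound
    (.of_forall fun _ => zero_le) ?_
  filter_upwards [Ioo_mem_nhdsGT one_pos, hlog.eventually_gt_atTop 0] with d hd hpos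
  have h := hC d hd.1
  rw [avgMeasure_Iio_of_ge hd.1 hd.2.le, ENNReal.ofReal_mul hd.1.le] at h
  refine ENNReal.div_le_of_le_mul ?_
  rw [← ENNReal.mul_div_right_comm, ENNReal.le_div_iff_mul_le (.inl (ENNReal.ofReal_pos.2 hpos).ne')
    (.inl ENNReal.ofReal_ne_top)]
  exact h

theorem limsup_avgMeasure_Iio_div_le (hgr : Growth φ) {s : ℝ} (hs : 0 < s) (t : ℝ) :
    limsup (fun d => avgMeasure t (Iio d) / hφ.dφ (Iio d)) (𝓝[>] 0) ≤
      limsup (fun d => avgMeasure s (Iio d) / hφ.dφ (Iio d)) (𝓝[>] 0) := by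
  set c := ENNReal.ofReal ((t - s) / s)
  have herr : Tendsto (fun d => c * (ENNReal.ofReal d / hφ.dφ (Iio d))) (𝓝[>] 0) (𝓝 0) := by
    simpa using ENNReal.Tendsto.const_mul (hφ.tendsto_ofReal_div_dφ_Iio hgr)
      (.inr ENNReal.ofReal_ne_top)
  calc limsup (fun d => avgMeasure t (Iio d) / hφ.dφ (Iio d)) (𝓝[>] 0)
      ≤ limsup ((fun d => avgMeasure s (Iio d) / hφ.dφ (Iio d)) +
          fun d => c * (ENNReal.ofReal d / hφ.dφ (Iio d))) (𝓝[>] 0) := by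
        refine limsup_le_limsup ?_
        filter_upwards [self_mem_nhdsWithin] with d hd
        rw [Pi.add_apply, ← mul_div_assoc, ← ENNReal.add_div, mul_comm,
          ← ENNReal.ofReal_mul (le_of_lt hd)]
        gcongr
        exact avgMeasure_Iio_le_add hs hd t
    _ ≤ _ := (ENNReal.limsup_add_of_right_tendsto_zero herr _).le

theorem limsup_avgMeasure_Iio_div (hgr : Growth φ) {t : ℝ} (ht : 0 < t) :
    limsup (fun d => avgMeasure t (Iio d) / hφ.dφ (Iio d)) (𝓝[>] 0) = hφ.critConst :=
  le_antisymm (hφ.limsup_avgMeasure_Iio_div_le hgr one_pos t)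
    (hφ.limsup_avgMeasure_Iio_div_le hgr ht 1)

theorem exists_avgMeasure_Iio_le_of_critConst_lt (hgr : Growth φ) {t : ℝ} (ht : 0 < t) {κ : ℝ≥0∞}
    (hκ : hφ.critConst < κ) :
    ∃ δ, 0 < δ ∧ ∀ d, 0 < d → d ≤ δ → avgMeasure t (Iio d) ≤ κ * hφ.dφ (Iio d) := by
  rw [← hφ.limsup_avgMeasure_Iio_div hgr ht] at hκ
  obtain ⟨δ, hδ, hsub⟩ := mem_nhdsGT_iff_exists_Ioc_subset.1 (eventually_lt_of_limsup_lt hκ)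
  refine ⟨δ, hδ, fun d hd hdδ => ?_⟩
  have hlt : avgMeasure t (Iio d) / hφ.dφ (Iio d) < κ := hsub ⟨hd, hdδ⟩
  exact (ENNReal.div_le_iff (hφ.dφ_Iio_ne_zero hd) (hφ.dφ_Iio_ne_top hd)).1 hlt.le

theorem exists_mul_dφ_Iio_le_of_lt_critConst (hgr : Growth φ) {t : ℝ} (ht : 0 < t) {κ : ℝ≥0∞}
    (hκ : κ < hφ.critConst) : ∃ a, 0 < a ∧ κ * hφ.dφ (Iio a) ≤ avgMeasure t (Iio a) := by
  rw [← hφ.limsup_avgMeasure_Iio_div hgr ht] at hκ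
  obtain ⟨a, hκa, ha⟩ := ((frequently_lt_of_lt_limsup (by isBoundedDefault) hκ).and_eventually
    self_mem_nhdsWithin).exists
  exact ⟨a, ha, ENNReal.mul_le_of_le_div hκa.le⟩

end QuasiConcave

/-! ### The Fatou property -/

/-- Helly's selection principle. -/
theorem exists_subseq_tendsto {G : ℕ → ℝ → ℝ≥0∞} (hG : ∀ n, Antitone (G n)) :
    ∃ ψ : ℕ → ℕ, StrictMono ψ ∧ ∃ K, IsDecreasing K ∧
      (∀ t, K t ≤ liminf (fun k => G (ψ k) t) atTop) ∧
      ∀ᵐ t : ℝ, Tendsto (fun k => G (ψ k) t) atTop (𝓝 (K t)) := by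
  obtain ⟨x, ψ, hψ, hx⟩ := CompactSpace.tendsto_subseq fun n => fun q : ℚ => G n q
  rw [tendsto_pi_nhds] at hx
  set K : ℝ → ℝ≥0∞ := fun t => ⨆ (q : ℚ) (_ : t < q), x q with hK
  have hanti : Antitone K := fun a b hab =>
    iSup_mono fun q => iSup_le fun hq => le_iSup_of_le (hab.trans_lt hq) le_rfl
  have hlsc : LowerSemicontinuous K := lowerSemicontinuous_iff_isOpen_preimage.2 fun s => by
    have : K ⁻¹' Ioi s = ⋃ (q : ℚ) (_ : s < x q), Iio (q : ℝ) := by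
      ext t
      simp only [hK, mem_preimage, mem_Ioi, lt_iSup_iff, mem_iUnion, mem_Iio]
      exact ⟨fun ⟨q, h₁, h₂⟩ => ⟨q, h₂, h₁⟩, fun ⟨q, h₁, h₂⟩ => ⟨q, h₂, h₁⟩⟩
    exact this ▸ isOpen_biUnion fun _ _ => isOpen_Iio
  have hlow : ∀ t, K t ≤ liminf (fun k => G (ψ k) t) atTop := fun t => iSup₂_le fun q hq => by
    rw [← (hx q).liminf_eq]
    exact liminf_le_liminf (.of_forall fun k => hG (ψ k) hq.le)
  have hup : ∀ s t, s < t → limsup (fun k => G (ψ k) t) atTop ≤ K s := fun s t hst => by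
    obtain ⟨q, hsq, hqt⟩ := exists_rat_btwn hst
    refine le_trans ?_ (le_iSup₂_of_le q hsq le_rfl)
    rw [← (hx q).limsup_eq]
    exact limsup_le_limsup (.of_forall fun k => hG (ψ k) hqt.le)
  refine ⟨ψ, hψ, K, ⟨hanti, hlsc⟩, hlow, ?_⟩
  filter_upwards [hanti.countable_not_continuousAt.ae_notMem volume] with t ht
  have hc : Tendsto K (𝓝[<] t) (𝓝 (K t)) := (not_not.1 ht).mono_left nhdsWithin_le_nhds
  exact tendsto_of_le_liminf_of_limsup_le (hlow t) <|
    ge_of_tendsto hc (eventually_mem_nhdsWithin.mono fun s hs => hup s t hs)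

theorem tendsto_lintegral_min {α : Type*} [MeasurableSpace α] {ν : Measure α} [IsFiniteMeasure ν]
    {G : ℕ → α → ℝ≥0∞} {K : α → ℝ≥0∞} (hG : ∀ n, Measurable (G n))
    (hlim : ∀ᵐ x ∂ν, Tendsto (fun n => G n x) atTop (𝓝 (K x))) {c : ℝ≥0∞} (hc : c ≠ ∞) :
    Tendsto (fun n => ∫⁻ x, min (G n x) c ∂ν) atTop (𝓝 (∫⁻ x, min (K x) c ∂ν)) := by
  refine tendsto_lintegral_of_dominated_convergence (fun _ => c)
    (fun n => (hG n).min measurable_const) (fun n => .of_forall fun x => min_le_right _ _) ?_ ?_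
  · simpa using ENNReal.mul_ne_top hc (measure_ne_top ν univ)
  · filter_upwards [hlim] with x hx using hx.min tendsto_const_nhds

theorem lintegral_min_le_liminf {α : Type*} [MeasurableSpace α] {ν : Measure α}
    {G : ℕ → α → ℝ≥0∞} {K : α → ℝ≥0∞} (hG : ∀ n, Measurable (G n))
    (hlow : ∀ x, K x ≤ liminf (fun n => G n x) atTop) (c : ℝ≥0∞) :
    ∫⁻ x, min (K x) c ∂ν ≤ liminf (fun n => ∫⁻ x, min (G n x) c ∂ν) atTop := by
  refine (lintegral_mono fun x => ?_).trans
    (lintegral_liminf_le fun n => (hG n).min measurable_const)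
  rw [liminf_min, liminf_const]
  exact min_le_min_right c (hlow x)

theorem tsum_mul_inv_two_pow (S : ℝ≥0∞) (m : ℕ) :
    ∑' i, S * 2⁻¹ ^ (m + i + 1) = S * 2⁻¹ ^ m := by
  simp_rw [add_assoc, pow_add _ m, ENNReal.tsum_mul_left, pow_succ, ENNReal.tsum_mul_right,
    ENNReal.tsum_geometric, ENNReal.one_sub_inv_two]
  simp [ENNReal.mul_inv_cancel]

theorem exists_seq_apply_le {h : ℝ → ℝ≥0∞} (h₀ : Tendsto h (𝓝[>] 0) (𝓝 0))
    {b : ℕ → ℝ≥0∞} (hb : ∀ i, b i ≠ 0) :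
    ∃ u : ℕ → ℝ, Antitone u ∧ (∀ i, 0 < u i) ∧ Tendsto u atTop (𝓝 0) ∧ ∀ i, h (u i) ≤ b i := by
  obtain ⟨v, hv, hv₀, hlim⟩ := exists_seq_strictAnti_tendsto (0 : ℝ)
  have hv' : Tendsto v atTop (𝓝[>] 0) := tendsto_nhdsWithin_iff.2 ⟨hlim, .of_forall hv₀⟩
  obtain ⟨ψ, hψ, hle⟩ := extraction_forall_of_eventually (P := fun i n => h (v n) ≤ b i)
    fun i => ((h₀.comp hv').eventually_lt_const (pos_iff_ne_zero.2 (hb i))).mono fun _ hn => hn.le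
  exact ⟨v ∘ ψ, hv.antitone.comp_monotone hψ.monotone, fun i => hv₀ _,
    hlim.comp hψ.tendsto_atTop, hle⟩

namespace QuasiConcave

variable {φ : ℝ → ℝ} (hφ : QuasiConcave φ)

/-- Split `G = (G - c) + min G c`: only the first summand, which lives near `0`, is charged with
the constant `κ`. -/
theorem add_lintegral_min_le {G : ℝ → ℝ≥0∞} (hG : IsDecreasing G) {M c κ h : ℝ≥0∞}
    (hM : ∫⁻ x, G x ∂hφ.dφ ≤ M) {t δ : ℝ} (hδ : G δ ≤ c)
    (hκ : ∀ d, 0 < d → d ≤ δ → avgMeasure t (Iio d) ≤ κ * hφ.dφ (Iio d))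
    (hle : h ≤ ∫⁻ x, G x ∂avgMeasure t) :
    h + κ * ∫⁻ x, min (G x) c ∂hφ.dφ ≤ κ * M + ∫⁻ x, min (G x) c ∂avgMeasure t := by
  have hk := hG.sub_const c
  have hsplit (ν : Measure ℝ) : ∫⁻ x, G x ∂ν = ∫⁻ x, G x - c ∂ν + ∫⁻ x, min (G x) c ∂ν := by
    rw [← lintegral_add_left hk.measurable]
    simp only [tsub_add_min]
  have hsub : ∫⁻ x, G x - c ∂avgMeasure t ≤ κ * ∫⁻ x, G x - c ∂hφ.dφ :=
    hk.lintegral_le_mul (avgMeasure_Iio_zero t) fun d hd hne => hκ d hd <| not_lt.1 fun hlt =>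
      hne (tsub_eq_zero_of_le ((hG.antitone hlt.le).trans hδ))
  rw [hsplit] at hM hle
  calc h + κ * ∫⁻ x, min (G x) c ∂hφ.dφ
      ≤ κ * ∫⁻ x, G x - c ∂hφ.dφ + ∫⁻ x, min (G x) c ∂avgMeasure t +
        κ * ∫⁻ x, min (G x) c ∂hφ.dφ := by gcongr; exact hle.trans (by gcongr)
    _ = κ * (∫⁻ x, G x - c ∂hφ.dφ + ∫⁻ x, min (G x) c ∂hφ.dφ) +
        ∫⁻ x, min (G x) c ∂avgMeasure t := by ring
    _ ≤ _ := by gcongr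

section Limit

variable {G : ℕ → ℝ → ℝ≥0∞} {K : ℝ → ℝ≥0∞} {M h : ℝ≥0∞} {t : ℝ}

theorem add_mul_lintegral_le_of_critConst_lt (hgr : Growth φ) (hG : ∀ n, IsDecreasing (G n))
    (hK : Measurable K) (hlow : ∀ x, K x ≤ liminf (fun n => G n x) atTop)
    (hlim : ∀ᵐ x : ℝ, Tendsto (fun n => G n x) atTop (𝓝 (K x))) (hM : M ≠ ∞)
    (hGM : ∀ n, ∫⁻ x, G n x ∂hφ.dφ ≤ M) (ht : 0 < t)
    (hle : ∀ᶠ n in atTop, h ≤ ∫⁻ x, G n x ∂avgMeasure t) {κ : ℝ≥0∞} (hκ : hφ.critConst < κ)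
    (hκ' : κ ≠ ∞) :
    h + κ * ∫⁻ x, K x ∂hφ.dφ ≤ κ * M + ∫⁻ x, K x ∂avgMeasure t := by
  obtain ⟨δ, hδ, hκδ⟩ := hφ.exists_avgMeasure_Iio_le_of_critConst_lt hgr ht hκ
  rw [lintegral_eq_iSup_min_natCast _ hK, ENNReal.mul_iSup, ENNReal.add_iSup]
  refine iSup_le fun m => ?_
  set c : ℝ≥0∞ := max m (M / hφ.dφ (Iio δ))
  have hc : c ≠ ∞ := (max_lt (ENNReal.natCast_lt_top m)
    (ENNReal.div_lt_top hM (hφ.dφ_Iio_ne_zero hδ))).ne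
  have hGδ n : G n δ ≤ c := le_max_of_le_right <|
    (ENNReal.le_div_iff_mul_le (.inl (hφ.dφ_Iio_ne_zero hδ)) (.inl (hφ.dφ_Iio_ne_top hδ))).2
      ((hφ.mul_dφ_Iio_le (hG n).antitone δ).trans (hGM n))
  have hac : avgMeasure t ≪ volume :=
    (avgMeasure_absolutelyContinuous t).trans Measure.absolutelyContinuous_restrict
  have hlimc := tendsto_lintegral_min (fun n => (hG n).measurable) (hac.ae_le hlim) hc
  set F : ℝ≥0∞ → ℝ≥0∞ := fun a => h + κ * a with hF
  have hFmono : Monotone F := fun a b hab => by simp only [hF]; gcongr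
  have hFcont : Continuous F := continuous_const.add (ENNReal.continuous_const_mul hκ')
  calc F (∫⁻ x, min (K x) m ∂hφ.dφ) ≤ F (∫⁻ x, min (K x) c ∂hφ.dφ) :=
        hFmono (lintegral_mono fun x => min_le_min_left _ (le_max_left _ _))
    _ ≤ F (liminf (fun n => ∫⁻ x, min (G n x) c ∂hφ.dφ) atTop) :=
        hFmono (lintegral_min_le_liminf (fun n => (hG n).measurable) hlow c)
    _ = liminf (fun n => F (∫⁻ x, min (G n x) c ∂hφ.dφ)) atTop :=
        hFmono.map_liminf_of_continuousAt _ hFcont.continuousAt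
    _ ≤ liminf (fun n => κ * M + ∫⁻ x, min (G n x) c ∂avgMeasure t) atTop :=
        liminf_le_liminf <| hle.mono fun n hn =>
          hφ.add_lintegral_min_le (hG n) (hGM n) (hGδ n) hκδ hn
    _ = κ * M + ∫⁻ x, min (K x) c ∂avgMeasure t := (hlimc.const_add _).liminf_eq
    _ ≤ κ * M + ∫⁻ x, K x ∂avgMeasure t := by gcongr; exact min_le_left _ _

theorem exists_limit (hgr : Growth φ) (hG : ∀ n, IsDecreasing (G n)) (hM : M ≠ ∞)
    (hGM : ∀ n, ∫⁻ x, G n x ∂hφ.dφ ≤ M) {h : ℕ → ℝ → ℝ≥0∞} (hmono : ∀ t, Monotone fun n => h n t)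
    (hle : ∀ n t, 0 < t → h n t ≤ ∫⁻ x, G n x ∂avgMeasure t) :
    ∃ K, IsDecreasing K ∧ ∫⁻ x, K x ∂hφ.dφ ≤ M ∧ ∀ t, 0 < t →
      (⨆ n, h n t) + hφ.critConst * ∫⁻ x, K x ∂hφ.dφ ≤
        hφ.critConst * M + ∫⁻ x, K x ∂avgMeasure t := by
  obtain ⟨ψ, hψ, K, hK, hlow, hlim⟩ := exists_subseq_tendsto fun n => (hG n).antitone
  have hKM : ∫⁻ x, K x ∂hφ.dφ ≤ M := calc
    ∫⁻ x, K x ∂hφ.dφ ≤ ∫⁻ x, liminf (fun k => G (ψ k) x) atTop ∂hφ.dφ := lintegral_mono hlow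
    _ ≤ liminf (fun k => ∫⁻ x, G (ψ k) x ∂hφ.dφ) atTop :=
      lintegral_liminf_le fun k => (hG _).measurable
    _ ≤ M := liminf_le_of_frequently_le' (Frequently.of_forall fun k => hGM _)
  refine ⟨K, hK, hKM, fun t ht => ?_⟩
  rw [ENNReal.iSup_add]
  refine iSup_le fun j => ?_
  have hev : ∀ᶠ k in atTop, h j t ≤ ∫⁻ x, G (ψ k) x ∂avgMeasure t :=
    (eventually_ge_atTop j).mono fun k hk => (hmono t (hk.trans hψ.le_apply)).trans (hle _ t ht)
  have hlt := (hφ.critConst_ne_top hgr).lt_top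
  have : (𝓝[>] hφ.critConst).NeBot := nhdsGT_neBot_of_exists_gt ⟨∞, hlt⟩
  have hcont a (ha : a ≠ ∞) :
      Tendsto (fun κ => κ * a) (𝓝[>] hφ.critConst) (𝓝 (hφ.critConst * a)) :=
    (ENNReal.continuous_mul_const ha).continuousAt.mono_left nhdsWithin_le_nhds
  refine le_of_tendsto_of_tendsto ((hcont _ (ne_top_of_le_ne_top hM hKM)).const_add _)
    ((hcont _ hM).add_const _) ?_
  filter_upwards [Ioo_mem_nhdsGT hlt] with κ hκ
  exact hφ.add_mul_lintegral_le_of_critConst_lt hgr (fun k => hG (ψ k)) hK.measurable hlow hlim hM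
    (fun k => hGM _) ht hev hκ.1 hκ.2.ne

end Limit

theorem exists_mul_le_lintegral_avgMeasure (hgr : Growth φ) {κ S : ℝ≥0∞} (hκ : κ < hφ.critConst)
    (hS : S ≠ ∞) {u : ℕ → ℝ} (hu : Antitone u) (hu₀ : ∀ i, 0 < u i) :
    ∃ k, IsDecreasing k ∧ ∫⁻ x, k x ∂hφ.dφ = S ∧
      ∀ m t, u m ≤ t → κ * (S * 2⁻¹ ^ m) ≤ ∫⁻ x, k x ∂avgMeasure t := by
  choose a ha₀ ha using fun i => hφ.exists_mul_dφ_Iio_le_of_lt_critConst hgr (hu₀ i) hκ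
  set w : ℕ → ℝ≥0∞ := fun i => S * 2⁻¹ ^ (i + 1) / hφ.dφ (Iio (a i))
  have hw i : w i * hφ.dφ (Iio (a i)) = S * 2⁻¹ ^ (i + 1) :=
    ENNReal.div_mul_cancel (hφ.dφ_Iio_ne_zero (ha₀ i)) (hφ.dφ_Iio_ne_top (ha₀ i))
  have hdec i : IsDecreasing fun x => w i * (Iio (a i)).indicator 1 x :=
    (isDecreasing_indicator_Iio (a i)).const_mul <|
      ENNReal.div_ne_top (ENNReal.mul_ne_top hS (by simp)) (hφ.dφ_Iio_ne_zero (ha₀ i))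
  have hint (ν : Measure ℝ) : ∫⁻ x, ∑' i, w i * (Iio (a i)).indicator 1 x ∂ν =
      ∑' i, w i * ν (Iio (a i)) := by
    rw [lintegral_tsum fun i => (hdec i).measurable.aemeasurable]
    refine tsum_congr fun i => ?_
    rw [lintegral_const_mul _ (isDecreasing_indicator_Iio (a i)).measurable,
      lintegral_indicator_one measurableSet_Iio]
  refine ⟨_, IsDecreasing.tsum hdec, ?_, fun m t hmt => ?_⟩
  · simp_rw [hint, hw]
    simpa using tsum_mul_inv_two_pow S 0
  · calc κ * (S * 2⁻¹ ^ m) = ∑' i, κ * (S * 2⁻¹ ^ (m + i + 1)) := by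
          rw [ENNReal.tsum_mul_left, tsum_mul_inv_two_pow]
      _ ≤ ∑' i, w (m + i) * avgMeasure t (Iio (a (m + i))) := by
          refine ENNReal.tsum_le_tsum fun i => ?_
          rw [← hw, mul_left_comm]
          gcongr
          exact (ha _).trans (avgMeasure_mono ((hu (Nat.le_add_right m i)).trans hmt) _)
      _ ≤ ∑' i, w i * avgMeasure t (Iio (a i)) :=
          ENNReal.tsum_comp_le_tsum_of_injective (add_right_injective m)
            fun i => w i * avgMeasure t (Iio (a i))
      _ = _ := (hint _).symm

/-- The Lorentz norm lost at `0` in `exists_limit` is restored by a sum of narrow spikes, each of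
them nearly extremal for `critConst`. -/
theorem exists_correction (hgr : Growth φ) {h : ℝ → ℝ≥0∞} (hmono : Monotone h)
    (h₀ : Tendsto h (𝓝[>] 0) (𝓝 0)) {N ε : ℝ≥0∞} (hN : N ≠ ∞) (hε : ε ≠ ∞) (hε₀ : ε ≠ 0)
    {A : ℝ → ℝ≥0∞} (hle : ∀ t, 0 < t → h t ≤ hφ.critConst * N + A t) :
    ∃ k, IsDecreasing k ∧ ∫⁻ x, k x ∂hφ.dφ ≤ N + ε ∧
      ∀ t, 0 < t → h t ≤ ∫⁻ x, k x ∂avgMeasure t + A t := by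
  rcases eq_or_ne hφ.critConst 0 with hκ | hκ
  · refine ⟨0, isDecreasing_zero, by simp, fun t ht => ?_⟩
    simpa [hκ] using hle t ht
  have hS : N + ε ≠ ∞ := ENNReal.add_ne_top.2 ⟨hN, hε⟩
  have hS₀ : N + ε ≠ 0 := by simp [hε₀]
  obtain ⟨κ, hNκ, hκlt⟩ : ∃ κ, hφ.critConst * N / (N + ε) < κ ∧ κ < hφ.critConst := by
    refine exists_between ?_
    rw [ENNReal.div_lt_iff (.inl hS₀) (.inl hS)]
    exact ENNReal.mul_lt_mul_right hκ (hφ.critConst_ne_top hgr) (ENNReal.lt_add_right hN hε₀)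
  have hκS : hφ.critConst * N ≤ κ * (N + ε) := (ENNReal.div_le_iff hS₀ hS).1 hNκ.le
  obtain ⟨u, hu, hu₀, hulim, hhu⟩ := exists_seq_apply_le h₀
    (b := fun i => κ * ((N + ε) * 2⁻¹ ^ (i + 1))) fun i =>
      mul_ne_zero (pos_of_gt hNκ).ne' (mul_ne_zero hS₀ (pow_ne_zero _ (by simp)))
  obtain ⟨k, hk, hkS, htail⟩ := hφ.exists_mul_le_lintegral_avgMeasure hgr hκlt hS hu hu₀
  refine ⟨k, hk, hkS.le, fun t ht => ?_⟩
  classical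
  have hex : ∃ i, u i ≤ t := (hulim.eventually_lt_const ht).exists.imp fun _ h => h.le
  have hfirst := Nat.find_spec hex
  cases hm : Nat.find hex with
  | zero =>
    have := htail 0 t (hm ▸ hfirst)
    rw [pow_zero, mul_one] at this
    exact (hle t ht).trans (add_le_add_left (hκS.trans this) _)
  | succ m =>
    have hlt : t < u m := not_le.1 (Nat.find_min hex (by lia))
    exact (((hmono hlt.le).trans (hhu m)).trans (htail (m + 1) t (hm ▸ hfirst))).trans le_self_add

end QuasiConcave

/-! ### The range norm -/

section Hardy

variable {f : ℝ → ℝ}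

theorem absFun_hardy_le (hf : AEMeasurable f μ) {t : ℝ} (ht : 0 < t) :
    absFun (hardy f) t ≤ avg (rearr (absFun f)) t := by
  rw [absFun, hardy, enorm_mul, avg, intervalIntegral.integral_of_le ht.le, one_div,
    Real.enorm_of_nonneg (by positivity), ENNReal.ofReal_inv_of_pos ht]
  gcongr
  calc ‖∫ r in Ioc 0 t, f r‖ₑ ≤ ∫⁻ r in Ioc 0 t, ‖f r‖ₑ := enorm_integral_le_lintegral_enorm _
    _ = ∫⁻ r in Ioc 0 t, absFun f r ∂μ := by rw [μ_restrict_Ioc]; rfl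
    _ ≤ ∫⁻ r in Ioc 0 t, rearr (absFun f) r := setLIntegral_le_lintegral_rearr hf.enorm (μ_Ioc t).le

theorem aemeasurable_hardy (hf : AEMeasurable f μ) : AEMeasurable (hardy f) μ := by
  set D : Set (ℝ × ℝ) := {p | 0 < p.2 ∧ p.2 ≤ p.1}
  have hD : MeasurableSet D := (measurableSet_lt measurable_const measurable_snd).inter
    (measurableSet_le measurable_snd measurable_fst)
  have hint : Measurable fun t => ∫ r, D.indicator (fun p => hf.mk f p.2) (t, r) :=
    (StronglyMeasurable.integral_prod_right
      (f := fun t r => D.indicator (fun p => hf.mk f p.2) (t, r))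
      ((hf.measurable_mk.comp measurable_snd).indicator hD).stronglyMeasurable).measurable
  refine ⟨fun t => 1 / t * ∫ r, D.indicator (fun p => hf.mk f p.2) (t, r),
    (measurable_const.div measurable_id).mul hint, ae_μ_of_forall fun t ht => ?_⟩
  have hslice : (fun r => D.indicator (fun p => hf.mk f p.2) (t, r)) =
      (Ioc 0 t).indicator (hf.mk f) := by
    ext r
    simp only [D, indicator, mem_ofPred_eq, mem_Ioc]
  beta_reduce
  rw [hardy, intervalIntegral.integral_of_le ht.le, hslice, integral_indicator measurableSet_Ioc,
    ← μ_restrict_Ioc]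
  exact congrArg _ (integral_congr_ae (ae_restrict_of_ae hf.ae_eq_mk))

end Hardy

/-- The submajorization preorder of Hardy, Littlewood and Pólya, i.e. `f** ≤ g**`. -/
def Submajorized (f g : ℝ → ℝ≥0∞) : Prop :=
  ∀ t, 0 < t → ∫⁻ s in Ioc 0 t, rearr f s ≤ ∫⁻ s in Ioc 0 t, rearr g s

theorem submajorized_of_ae_le {f g : ℝ → ℝ≥0∞} (h : ∀ᵐ x ∂μ, f x ≤ g x) : Submajorized f g :=
  fun _ _ => lintegral_mono fun s => rearr_mono h s

/-- `G` is a decreasing function whose Hardy average submajorizes `f`. -/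
structure IsHardyMajorant (G f : ℝ → ℝ≥0∞) : Prop where
  isDecreasing : IsDecreasing G
  lintegral_rearr_le : ∀ t, 0 < t → ∫⁻ s in Ioc 0 t, rearr f s ≤ ∫⁻ x, G x ∂avgMeasure t

theorem isHardyMajorant_of_le_avg {G f : ℝ → ℝ≥0∞} (hG : IsDecreasing G)
    (h : ∀ t, 0 < t → rearr f t ≤ avg G t) : IsHardyMajorant G f where
  isDecreasing := hG
  lintegral_rearr_le t _ := by
    rw [lintegral_avgMeasure hG.measurable]
    exact setLIntegral_mono measurable_avg fun s hs => h s hs.1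

theorem isHardyMajorant_hardy {f : ℝ → ℝ} (hf : AEMeasurable f μ) :
    IsHardyMajorant (rearr (absFun f)) (absFun (hardy f)) :=
  isHardyMajorant_of_le_avg (isDecreasing_rearr _) fun t ht =>
    (rearr_mono (ae_μ_of_forall fun _ hx => absFun_hardy_le hf hx) t).trans
      (rearr_le_of_antitoneOn (antitoneOn_avg (antitone_rearr _)) ht)

namespace IsHardyMajorant

variable {G K f g : ℝ → ℝ≥0∞}

theorem of_submajorized (hG : IsHardyMajorant G g) (h : Submajorized f g) :
    IsHardyMajorant G f :=
  ⟨hG.1, fun t ht => (h t ht).trans (hG.2 t ht)⟩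

theorem add (hG : IsHardyMajorant G f) (hK : IsHardyMajorant K g) (hf : AEMeasurable f μ)
    (hg : AEMeasurable g μ) : IsHardyMajorant (G + K) fun x => f x + g x where
  isDecreasing := hG.1.add hK.1
  lintegral_rearr_le t ht := by
    simp only [Pi.add_apply, lintegral_add_left hG.1.measurable]
    exact (lintegral_rearr_add_le hf hg t).trans (add_le_add (hG.2 t ht) (hK.2 t ht))

theorem const_mul (hG : IsHardyMajorant G f) (a : ℝ≥0) :
    IsHardyMajorant (fun x => a * G x) fun x => a * f x where
  isDecreasing := hG.1.const_mul ENNReal.coe_ne_top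
  lintegral_rearr_le t ht := calc
    ∫⁻ s in Ioc 0 t, rearr (fun x => a * f x) s ≤ ∫⁻ s in Ioc 0 t, a * rearr f s :=
      lintegral_mono fun s => rearr_const_mul_le a f s
    _ = a * ∫⁻ s in Ioc 0 t, rearr f s := lintegral_const_mul _ (measurable_rearr f)
    _ ≤ a * ∫⁻ x, G x ∂avgMeasure t := mul_le_mul' le_rfl (hG.2 t ht)
    _ = ∫⁻ x, a * G x ∂avgMeasure t := (lintegral_const_mul _ hG.1.measurable).symm

end IsHardyMajorant

section Majorants

variable {φ : ℝ → ℝ} (hφ : QuasiConcave φ) {G f : ℝ → ℝ≥0∞}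

theorem isHardyMajorant_of_mem_majorants {hφ : QuasiConcave φ} {g : ℝ → ℝ}
    (hg : g ∈ majorants hφ f) : IsHardyMajorant (rearr (absFun g)) f :=
  (isHardyMajorant_hardy hg.2.1.1).of_submajorized fun t ht => (maxRearr_le_iff ht).1 (hg.2.2 t ht)

theorem absFun_toReal_le (G : ℝ → ℝ≥0∞) (x : ℝ) : absFun (fun x => (G x).toReal) x ≤ G x := by
  rw [absFun, Real.enorm_of_nonneg ENNReal.toReal_nonneg]
  exact ENNReal.ofReal_toReal_le

theorem absFun_hardy_toReal (hG : IsDecreasing G) (h : ∫⁻ x, G x ∂hφ.dφ < ∞) {t : ℝ}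
    (ht : 0 < t) : absFun (hardy fun x => (G x).toReal) t = avg G t := by
  have hG_fin : ∀ r ∈ Ioc 0 t, G r < ∞ := fun r hr =>
    hφ.lt_top_of_lintegral_lt_top hG.antitone h hr.1
  rw [absFun, hardy, intervalIntegral.integral_of_le ht.le, enorm_mul, avg, one_div,
    integral_toReal hG.measurable.aemeasurable
      ((ae_restrict_iff' measurableSet_Ioc).2 (.of_forall hG_fin)),
    Real.enorm_of_nonneg (by positivity), ENNReal.ofReal_inv_of_pos ht,
    Real.enorm_of_nonneg ENNReal.toReal_nonneg,
    ENNReal.ofReal_toReal (hφ.lintegral_Ioc_lt_top hG h ht).ne]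

theorem lorentzNorm_toReal_le (hG : IsDecreasing G) :
    lorentzNorm hφ (fun x => (G x).toReal) ≤ ∫⁻ x, G x ∂hφ.dφ := by
  refine lintegral_mono_ae (hφ.ae_dφ_of_forall fun x hx => ?_)
  exact (rearr_mono (.of_forall (absFun_toReal_le G)) x).trans (rearr_le_of_antitone hG.antitone hx)

theorem IsHardyMajorant.mem_majorants (hG : IsHardyMajorant G f)
    (hfin : ∫⁻ x, G x ∂hφ.dφ < ∞) : (fun x => (G x).toReal) ∈ majorants hφ f := by
  refine ⟨fun a ha b _ hab => ENNReal.toReal_mono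
      (hφ.lt_top_of_lintegral_lt_top hG.1.antitone hfin ha).ne (hG.1.antitone hab),
    ⟨hG.1.measurable.ennreal_toReal.aemeasurable,
      (lorentzNorm_toReal_le hφ hG.1).trans_lt hfin⟩, fun t ht => ?_⟩
  have hae : absFun (hardy fun x => (G x).toReal) =ᵐ[μ] avg G :=
    ae_μ_of_forall fun x hx => absFun_hardy_toReal hφ hG.1 hfin hx
  rw [maxRearr_le_iff ht, rearr_congr hae]
  calc ∫⁻ s in Ioc 0 t, rearr f s ≤ ∫⁻ s in Ioc 0 t, avg G s ∂μ := by
        rw [μ_restrict_Ioc, ← lintegral_avgMeasure hG.1.measurable]; exact hG.2 t ht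
    _ ≤ ∫⁻ s in Ioc 0 t, rearr (avg G) s :=
        setLIntegral_le_lintegral_rearr measurable_avg.aemeasurable (μ_Ioc t).le

end Majorants

theorem absFun_toReal_ae_eq {f : ℝ → ℝ≥0∞} (h : ∀ᵐ x ∂μ, f x < ∞) :
    absFun (fun x => (f x).toReal) =ᵐ[μ] f := by
  filter_upwards [h] with x hx
  rw [absFun, Real.enorm_of_nonneg ENNReal.toReal_nonneg, ENNReal.ofReal_toReal hx.ne]

theorem exists_mem_L1AddLinfty {f : ℝ → ℝ≥0∞} (hf : AEMeasurable f μ)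
    (h : ∫⁻ s in Ioc 0 1, rearr f s < ∞) : ∃ h ∈ L1AddLinfty, f =ᵐ[μ] absFun h := by
  have hae := absFun_toReal_ae_eq (ae_lt_top_of_lintegral_rearr_lt_top hf one_pos h)
  exact ⟨_, mem_L1AddLinfty hf.ennreal_toReal (by rwa [rearr_congr hae]), hae.symm⟩

section RangeNorm

variable {φ : ℝ → ℝ} (hφ : QuasiConcave φ) (hgr : Growth φ) {f g : ℝ → ℝ≥0∞}

include hgr

theorem rangeNorm_eq (hf : AEMeasurable f μ) :
    rangeNorm hφ f = ⨅ (G : ℝ → ℝ≥0∞) (_ : IsHardyMajorant G f), ∫⁻ x, G x ∂hφ.dφ := by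
  refine le_antisymm (le_iInf₂ fun G hG => ?_) (le_iInf₂ fun g hg =>
    iInf₂_le_of_le _ (isHardyMajorant_of_mem_majorants hg.2) le_rfl)
  rcases eq_top_or_lt_top (∫⁻ x, G x ∂hφ.dφ) with htop | hfin
  · exact htop ▸ le_top
  · exact iInf₂_le_of_le _ ⟨exists_mem_L1AddLinfty hf ((hG.2 1 one_pos).trans_lt
      (hφ.lintegral_avgMeasure_lt_top hgr hG.1 hfin one_pos)), hG.mem_majorants hφ hfin⟩
      (lorentzNorm_toReal_le hφ hG.1)

theorem rangeNorm_le (hf : AEMeasurable f μ) {G : ℝ → ℝ≥0∞} (hG : IsHardyMajorant G f) :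
    rangeNorm hφ f ≤ ∫⁻ x, G x ∂hφ.dφ :=
  (rangeNorm_eq hφ hgr hf).trans_le (iInf₂_le G hG)

theorem exists_isHardyMajorant_of_rangeNorm_lt (hf : AEMeasurable f μ) {c : ℝ≥0∞}
    (hc : rangeNorm hφ f < c) : ∃ G, IsHardyMajorant G f ∧ ∫⁻ x, G x ∂hφ.dφ < c := by
  simpa [rangeNorm_eq hφ hgr hf, iInf_lt_iff] using hc

theorem rangeNorm_mono (hf : AEMeasurable f μ) (hg : AEMeasurable g μ) (h : Submajorized f g) :
    rangeNorm hφ f ≤ rangeNorm hφ g := by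
  rw [rangeNorm_eq hφ hgr hg]
  exact le_iInf₂ fun G hG => rangeNorm_le hφ hgr hf (hG.of_submajorized h)

theorem exists_lintegral_rearr_le {t : ℝ} (ht : 0 < t) :
    ∃ C : ℝ≥0, ∀ f, AEMeasurable f μ → ∫⁻ s in Ioc 0 t, rearr f s ≤ C * rangeNorm hφ f := by
  obtain ⟨C, hC⟩ := hφ.exists_lintegral_avgMeasure_le hgr ht
  refine ⟨C + 1, fun f hf => ?_⟩
  have hC₀ : ((C + 1 : ℝ≥0) : ℝ≥0∞) ≠ 0 := ENNReal.coe_ne_zero.2 (by positivity)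
  simp only [rangeNorm_eq hφ hgr hf, ENNReal.mul_iInf_of_ne hC₀ ENNReal.coe_ne_top]
  refine le_iInf₂ fun G hG => ((hG.2 t ht).trans (hC G hG.1)).trans ?_
  gcongr
  exact le_self_add

theorem rangeNorm_eq_zero_iff (hf : AEMeasurable f μ) : rangeNorm hφ f = 0 ↔ f =ᵐ[μ] 0 := by
  refine ⟨fun h => ae_eq_zero_of_lintegral_rearr_eq_zero fun t ht => ?_, fun h => ?_⟩
  · obtain ⟨C, hC⟩ := exists_lintegral_rearr_le hφ hgr ht
    simpa [h] using hC f hf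
  · have hG : IsHardyMajorant 0 f := ⟨isDecreasing_zero, fun t _ => by simp [rearr_eq_zero h]⟩
    simpa using rangeNorm_le hφ hgr hf hG

theorem rangeNorm_const_mul_le (a : ℝ≥0) (ha : a ≠ 0) (hf : AEMeasurable f μ) :
    rangeNorm hφ (fun x => a * f x) ≤ a * rangeNorm hφ f := by
  simp only [rangeNorm_eq hφ hgr hf, ENNReal.mul_iInf_of_ne (ENNReal.coe_ne_zero.2 ha)
    ENNReal.coe_ne_top]
  refine le_iInf₂ fun G hG => ?_
  rw [← lintegral_const_mul _ hG.1.measurable]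
  exact rangeNorm_le hφ hgr (hf.const_mul _) (hG.const_mul a)

theorem rangeNorm_const_mul (a : ℝ≥0) (hf : AEMeasurable f μ) :
    rangeNorm hφ (fun x => a * f x) = a * rangeNorm hφ f := by
  rcases eq_or_ne a 0 with rfl | ha
  · simp only [ENNReal.coe_zero, zero_mul]
    exact (rangeNorm_eq_zero_iff hφ hgr aemeasurable_const).2 .rfl
  · have hinv : (a : ℝ≥0∞) * (a⁻¹ : ℝ≥0) = 1 := by
      rw [← ENNReal.coe_mul, mul_inv_cancel₀ ha, ENNReal.coe_one]
    refine le_antisymm (rangeNorm_const_mul_le hφ hgr a ha hf) ?_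
    calc a * rangeNorm hφ f = a * rangeNorm hφ fun x => (a⁻¹ : ℝ≥0) * (a * f x) := by
          simp only [← mul_assoc, mul_comm _ (a : ℝ≥0∞), hinv, one_mul]
      _ ≤ a * ((a⁻¹ : ℝ≥0) * rangeNorm hφ fun x => a * f x) := by
          gcongr; exact rangeNorm_const_mul_le hφ hgr a⁻¹ (inv_ne_zero ha) (hf.const_mul _)
      _ = rangeNorm hφ fun x => a * f x := by rw [← mul_assoc, hinv, one_mul]

theorem rangeNorm_add_le (hf : AEMeasurable f μ) (hg : AEMeasurable g μ) :
    rangeNorm hφ (fun x => f x + g x) ≤ rangeNorm hφ f + rangeNorm hφ g := by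
  rw [rangeNorm_eq hφ hgr hf, rangeNorm_eq hφ hgr hg]
  refine ENNReal.le_iInf₂_add_iInf₂ fun G hG K hK => ?_
  rw [← lintegral_add_left hG.1.measurable]
  exact rangeNorm_le hφ hgr (hf.add hg) (hG.add hK hf hg)

theorem exists_isHardyMajorant_iSup {f G : ℕ → ℝ → ℝ≥0∞}
    (hmono : ∀ᵐ x ∂μ, Monotone fun n => f n x) (hG : ∀ n, IsHardyMajorant (G n) (f n)) {M : ℝ≥0∞}
    (hM : M ≠ ∞) (hGM : ∀ n, ∫⁻ x, G n x ∂hφ.dφ ≤ M) {ε : ℝ≥0∞} (hε : ε ≠ ∞) (hε₀ : ε ≠ 0) :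
    ∃ K, IsHardyMajorant K (fun x => ⨆ n, f n x) ∧ ∫⁻ x, K x ∂hφ.dφ ≤ M + ε := by
  have hmono' : Monotone fun n => rearr (f n) := fun m n hmn =>
    rearr_mono (hmono.mono fun x hx => hx hmn)
  obtain ⟨K, hK, hKM, hle⟩ := hφ.exists_limit hgr
    (h := fun n t => ∫⁻ s in Ioc 0 t, rearr (f n) s) (fun n => (hG n).1) hM hGM
    (fun t m n hmn => lintegral_mono (hmono' hmn)) fun n t ht => (hG n).2 t ht
  set N := M - ∫⁻ x, K x ∂hφ.dφ
  have hNM : N + ∫⁻ x, K x ∂hφ.dφ = M := tsub_add_cancel_of_le hKM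
  have hKtop : ∫⁻ x, K x ∂hφ.dφ ≠ ∞ := ne_top_of_le_ne_top hM hKM
  have hNtop : N ≠ ∞ := ENNReal.sub_ne_top hM
  have hκ := hφ.critConst_ne_top hgr
  set H : ℝ → ℝ≥0∞ := fun t => ∫⁻ s in Ioc 0 t, rearr (fun x => ⨆ n, f n x) s with hH
  have hdefect : ∀ t, 0 < t → H t ≤ hφ.critConst * N + ∫⁻ x, K x ∂avgMeasure t := fun t ht => by
    have hsup : H t = ⨆ n, ∫⁻ s in Ioc 0 t, rearr (f n) s := by
      simp only [hH, rearr_iSup hmono]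
      exact lintegral_iSup (fun n => measurable_rearr _) hmono'
    have := hle t ht
    rw [← hsup, ← hNM, mul_add, add_right_comm] at this
    exact (ENNReal.add_le_add_iff_right (ENNReal.mul_ne_top hκ hKtop)).1 this
  have hfin : H 1 < ∞ := (hdefect 1 one_pos).trans_lt <| ENNReal.add_lt_top.2
    ⟨(ENNReal.mul_ne_top hκ hNtop).lt_top,
      hφ.lintegral_avgMeasure_lt_top hgr hK hKtop.lt_top one_pos⟩
  obtain ⟨k, hk, hkN, hkle⟩ := hφ.exists_correction hgr
    (fun a b hab => lintegral_mono_set (Ioc_subset_Ioc_right hab))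
    (tendsto_lintegral_Ioc_zero hfin.ne) hNtop hε hε₀ hdefect
  refine ⟨k + K, ⟨hk.add hK, fun t ht => ?_⟩, ?_⟩
  · simpa only [Pi.add_apply, lintegral_add_left hk.measurable] using hkle t ht
  · simp only [Pi.add_apply, lintegral_add_left hk.measurable]
    calc ∫⁻ x, k x ∂hφ.dφ + ∫⁻ x, K x ∂hφ.dφ ≤ N + ε + ∫⁻ x, K x ∂hφ.dφ := by gcongr
      _ = M + ε := by rw [add_right_comm, hNM]

theorem rangeNorm_iSup {f : ℕ → ℝ → ℝ≥0∞} (hf : ∀ n, AEMeasurable (f n) μ)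
    (hmono : ∀ᵐ x ∂μ, Monotone fun n => f n x) :
    rangeNorm hφ (fun x => ⨆ n, f n x) = ⨆ n, rangeNorm hφ (f n) := by
  have hF : AEMeasurable (fun x => ⨆ n, f n x) μ := AEMeasurable.iSup hf
  refine le_antisymm (ENNReal.le_of_forall_pos_le_add fun ε hε hfin => ?_) (iSup_le fun n =>
    rangeNorm_mono hφ hgr (hf n) hF <|
      submajorized_of_ae_le (.of_forall fun x => le_iSup (fun n => f n x) n))
  have hε₀ : (ε / 2 : ℝ≥0∞) ≠ 0 := by simpa using hε.ne'
  have hεtop : (ε / 2 : ℝ≥0∞) ≠ ∞ := ENNReal.div_ne_top (by simp) (by simp)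
  choose G hG hGM using fun n => exists_isHardyMajorant_of_rangeNorm_lt hφ hgr (hf n)
    ((le_iSup (fun n => rangeNorm hφ (f n)) n).trans_lt (ENNReal.lt_add_right hfin.ne hε₀))
  obtain ⟨K, hK, hKle⟩ := exists_isHardyMajorant_iSup hφ hgr hmono hG
    (ENNReal.add_ne_top.2 ⟨hfin.ne, hεtop⟩) (fun n => (hGM n).le) hεtop hε₀
  refine (rangeNorm_le hφ hgr hF hK).trans (hKle.trans_eq ?_)
  rw [add_assoc, ENNReal.add_halves]

theorem rangeNorm_indicator_lt_top {E : Set ℝ} (hE : MeasurableSet E) (hEfin : μ E < ∞) :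
    rangeNorm hφ (E.indicator fun _ => 1) < ∞ := by
  obtain ⟨T, hT, hET⟩ := exists_le_ofReal hEfin.ne
  have hd := isDecreasing_indicator_Iio T
  have hG : IsHardyMajorant ((Iio T).indicator 1) (E.indicator fun _ => 1) :=
    isHardyMajorant_of_le_avg hd fun t ht =>
      (rearr_indicator_le hET t).trans (le_avg hd.antitone ht)
  refine (rangeNorm_le hφ hgr (aemeasurable_const.indicator hE) hG).trans_lt ?_
  rw [lintegral_indicator_one measurableSet_Iio]
  exact (hφ.dφ_Iio_ne_top hT).lt_top

theorem isRIBanachFunctionNorm_rangeNorm : IsRIBanachFunctionNorm (rangeNorm hφ) where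
  eq_zero_iff _ hf := rangeNorm_eq_zero_iff hφ hgr hf
  smul a _ hf := rangeNorm_const_mul hφ hgr a hf
  add_le _ _ hf hg := rangeNorm_add_le hφ hgr hf hg
  mono _ _ hf hg h := rangeNorm_mono hφ hgr hf hg (submajorized_of_ae_le h)
  fatou _ hf hm := rangeNorm_iSup hφ hgr hf hm
  indicator_lt_top _ hE hfin := rangeNorm_indicator_lt_top hφ hgr hE hfin
  lintegral_le E _ hfin := by
    obtain ⟨T, hT, hET⟩ := exists_le_ofReal hfin.ne
    obtain ⟨C, hC⟩ := exists_lintegral_rearr_le hφ hgr hT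
    exact ⟨C, fun f hf => (setLIntegral_le_lintegral_rearr hf hET).trans (hC f hf)⟩
  rearrangement_invariant f g hf hg h := by
    have := rearr_eq_of_distr_eq h
    exact le_antisymm (rangeNorm_mono hφ hgr hf hg fun _ _ => by rw [this])
      (rangeNorm_mono hφ hgr hg hf fun _ _ => by rw [this])

theorem hardyBounded_rangeNorm : HardyBounded hφ (rangeNorm hφ) := by
  refine ⟨1, fun f hf => ?_⟩
  rw [ENNReal.coe_one, one_mul]
  exact rangeNorm_le hφ hgr (aemeasurable_hardy hf.1).enorm (isHardyMajorant_hardy hf.1)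

theorem functionSpace_rangeNorm : functionSpace (rangeNorm hφ) = rangeSpace hφ := by
  ext f
  constructor
  · rintro ⟨hf, hfin⟩
    obtain ⟨G, hG, hGfin⟩ := exists_isHardyMajorant_of_rangeNorm_lt hφ hgr hf.enorm hfin
    exact ⟨mem_L1AddLinfty hf ((hG.2 1 one_pos).trans_lt
      (hφ.lintegral_avgMeasure_lt_top hgr hG.1 hGfin one_pos)), _, hG.mem_majorants hφ hGfin⟩
  · rintro ⟨⟨a, b, ha, hb, hab⟩, g, hg⟩
    have hf : AEMeasurable f μ := (ha.1.aemeasurable.add hb.1.aemeasurable).congr hab.symm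
    exact ⟨hf, (rangeNorm_le hφ hgr hf.enorm (isHardyMajorant_of_mem_majorants hg)).trans_lt
      hg.2.1.2⟩

end RangeNorm

/-! ### Monotonicity of rearrangement invariant norms under submajorization -/

theorem exists_le_convexCombination {ι κ : Type*} [Fintype ι] [Fintype κ] {x : ι → ℝ}
    {y : κ → ι → ℝ} (h : ∀ c : ι → ℝ, 0 ≤ c → ∃ k, ∑ i, c i * x i ≤ ∑ i, c i * y k i) :
    ∃ w ∈ stdSimplex ℝ κ, ∀ i, x i ≤ ∑ k, w k * y k i := by
  classical
  let L : (κ → ℝ) →L[ℝ] ι → ℝ := ∑ k, (ContinuousLinearMap.proj k).smulRight (y k)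
  have hL : ∀ w i, L w i = ∑ k, w k * y k i := fun w i => by simp [L]
  by_contra! hcon
  have hdisj : Disjoint (L '' stdSimplex ℝ κ) (Ici x) := disjoint_left.2 <| by
    rintro _ ⟨w, hw, rfl⟩ hx
    obtain ⟨i, hi⟩ := hcon w hw
    exact (hL w i ▸ hi).not_ge (hx i)
  obtain ⟨ψ, u, v, hu, huv, hv⟩ := geometric_hahn_banach_compact_closed
    ((convex_stdSimplex ℝ κ).linear_image L.toLinearMap)
    ((isCompact_stdSimplex ℝ κ).image L.continuous) (convex_Ici x) isClosed_Ici hdisj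
  set c : ι → ℝ := fun i => ψ (Pi.single i 1)
  have hψ : ∀ z, ψ z = ∑ i, c i * z i := fun z => by
    conv_lhs => rw [pi_eq_sum_univ' z]
    simp [c, mul_comm, map_sum]
  have hc : 0 ≤ c := fun i => by
    by_contra! hi
    have hmem : x + ((ψ x - v) / (- c i)) • Pi.single i 1 ∈ Ici x := mem_Ici.2 <|
      le_add_of_nonneg_right <| smul_nonneg
        (div_nonneg (sub_nonneg.2 (hv x self_mem_Ici).le) (neg_pos.2 hi).le)
        (Pi.single_nonneg.2 zero_le_one)
    have := hv _ hmem
    rw [map_add, map_smul, smul_eq_mul, div_neg, neg_mul, div_mul_cancel₀ _ hi.ne] at this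
    linarith
  obtain ⟨k, hk⟩ := h c hc
  have hyk : L (Pi.single k 1) = y k := by ext i; simp [hL, Pi.single_apply]
  have := hu _ ⟨_, single_mem_stdSimplex ℝ k, hyk⟩
  rw [hψ] at this
  linarith [hv x self_mem_Ici, hψ x]

theorem mul_sum_range_le_sum_range_mul {c d : ℕ → ℝ} (hc : Antitone c)
    (hd : ∀ k, 0 ≤ ∑ i ∈ Finset.range k, d i) (n : ℕ) :
    c n * ∑ i ∈ Finset.range n, d i ≤ ∑ i ∈ Finset.range n, c i * d i := by
  induction n with
  | zero => simp
  | succ n ih =>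
    calc c (n + 1) * ∑ i ∈ Finset.range (n + 1), d i
        ≤ c n * ∑ i ∈ Finset.range (n + 1), d i :=
          mul_le_mul_of_nonneg_right (hc n.le_succ) (hd _)
      _ = c n * ∑ i ∈ Finset.range n, d i + c n * d n := by rw [Finset.sum_range_succ, mul_add]
      _ ≤ ∑ i ∈ Finset.range (n + 1), c i * d i := by
          rw [Finset.sum_range_succ]; gcongr

theorem exists_perm_sum_mul_le {n : ℕ} {x y : ℕ → ℝ} (hx : Antitone x)
    (hxy : ∀ k, ∑ i ∈ Finset.range k, x i ≤ ∑ i ∈ Finset.range k, y i) {c : Fin n → ℝ}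
    (hc : 0 ≤ c) :
    ∃ π : Equiv.Perm (Fin n), ∑ i : Fin n, c i * x i ≤ ∑ i : Fin n, c i * y (π i) := by
  set τ := Tuple.sort (-c)
  have hτ : Antitone (c ∘ τ) := fun i j hij => neg_le_neg_iff.1 (Tuple.monotone_sort (-c) hij)
  set e : ℕ → ℝ := fun i => if h : i < n then c (τ ⟨i, h⟩) else 0
  have he : Antitone e := fun i j hij => by
    by_cases hj : j < n
    · simpa [e, hj, hij.trans_lt hj] 
        using hτ (show (⟨i, hij.trans_lt hj⟩ : Fin n) ≤ ⟨j, hj⟩ from hij)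
    · simp only [e, hj, dite_false]
      split_ifs with hi
      exacts [hc _, le_rfl]
  have hsum : ∑ i : Fin n, c (τ i) * x i ≤ ∑ i : Fin n, c (τ i) * y i := by
    have habel := mul_sum_range_le_sum_range_mul (d := fun i => y i - x i) he
      (fun k => by simpa using hxy k) n
    have he_eq : ∀ i : Fin n, e i = c (τ i) := fun i => by simp [e]
    rw [← Fin.sum_univ_eq_sum_range (fun i => e i * (y i - x i))] at habel
    simpa [he_eq, mul_sub, e] using habel
  refine ⟨τ⁻¹, ?_⟩
  calc ∑ i : Fin n, c i * x i = ∑ i, c (τ i) * x (τ i) :=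
        (Equiv.sum_comp τ fun i => c i * x i).symm
    _ ≤ ∑ i : Fin n, c (τ i) * x i := by
        refine Monovary.sum_mul_comp_perm_le_sum_mul (f := c ∘ τ) (g := fun i : Fin n => x i) ?_
        exact hτ.monovary fun i j hij => hx hij
    _ ≤ ∑ i : Fin n, c (τ i) * y i := hsum
    _ = ∑ i : Fin n, c i * y (τ⁻¹ i : Fin n) := by
        simpa using Equiv.sum_comp τ fun i => c i * y (τ⁻¹ i : Fin n)

/-- The finite form of Rado's theorem on weak majorization. -/
theorem exists_le_convexCombination_perm (n : ℕ) {x y : ℕ → ℝ} (hx : Antitone x)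
    (hxy : ∀ k, ∑ i ∈ Finset.range k, x i ≤ ∑ i ∈ Finset.range k, y i) :
    ∃ w ∈ stdSimplex ℝ (Equiv.Perm (Fin n)), ∀ i : Fin n, x i ≤ ∑ π, w π * y (π i) :=
  exists_le_convexCombination (x := fun i : Fin n => x i)
    (y := fun (π : Equiv.Perm (Fin n)) i => y (π i)) fun _ hc => exists_perm_sum_mul_le hx hxy hc

/-- The function taking the value `x i` on `E i`, for pairwise disjoint sets `E i`, and `0`
elsewhere. -/
noncomputable def stepFun {ι : Type*} [Fintype ι] (E : ι → Set ℝ) (x : ι → ℝ≥0∞) (s : ℝ) : ℝ≥0∞ :=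
  ∑ i, (E i).indicator (fun _ => x i) s

section StepFun

variable {ι : Type*} [Fintype ι] {E : ι → Set ℝ}

theorem measurable_stepFun (hE : ∀ i, MeasurableSet (E i)) (x : ι → ℝ≥0∞) :
    Measurable (stepFun E x) :=
  Finset.measurable_fun_sum _ fun i _ => measurable_const.indicator (hE i)

theorem stepFun_of_mem (hd : Pairwise (Disjoint on E)) (x : ι → ℝ≥0∞) {i : ι} {s : ℝ}
    (hs : s ∈ E i) : stepFun E x s = x i := by
  rw [stepFun, Finset.sum_eq_single i, indicator_of_mem hs]
  · exact fun j _ hj => indicator_of_notMem (disjoint_left.1 (hd hj.symm) hs) _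
  · simp

theorem stepFun_of_notMem (x : ι → ℝ≥0∞) {s : ℝ} (hs : ∀ i, s ∉ E i) : stepFun E x s = 0 :=
  Finset.sum_eq_zero fun i _ => indicator_of_notMem (hs i) _

theorem distr_stepFun (hE : ∀ i, MeasurableSet (E i)) (hd : Pairwise (Disjoint on E))
    (x : ι → ℝ≥0∞) (a : ℝ≥0∞) : distr (stepFun E x) a = ∑ i, if a < x i then μ (E i) else 0 := by
  classical
  have hset : {s | a < stepFun E x s} = ⋃ i ∈ Finset.univ.filter (a < x ·), E i := by
    ext s
    simp only [mem_ofPred_eq, mem_iUnion, Finset.mem_filter, Finset.mem_univ, true_and,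
      exists_prop]
    by_cases hs : ∃ i, s ∈ E i
    · obtain ⟨i, hi⟩ := hs
      rw [stepFun_of_mem hd x hi]
      refine ⟨fun h => ⟨i, h, hi⟩, fun ⟨j, hj, hsj⟩ => ?_⟩
      rwa [hd.eq (not_disjoint_iff.2 ⟨s, hi, hsj⟩)]
    · push Not at hs
      simp [stepFun_of_notMem x hs, hs]
  rw [distr, hset, measure_biUnion_finset (fun i _ j _ hij => hd hij) fun i _ => hE i,
    Finset.sum_filter]

end StepFun

namespace IsRIBanachFunctionNorm

variable {σ : (ℝ → ℝ≥0∞) → ℝ≥0∞} (hσ : IsRIBanachFunctionNorm σ)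

include hσ

theorem sum_le {ι : Type*} (s : Finset ι) {f : ι → ℝ → ℝ≥0∞} (hf : ∀ i, AEMeasurable (f i) μ) :
    σ (fun x => ∑ i ∈ s, f i x) ≤ ∑ i ∈ s, σ (f i) := by
  classical
  induction s using Finset.induction_on with
  | empty => simpa using (hσ.eq_zero_iff _ aemeasurable_const).2 .rfl
  | insert a s ha ih =>
    simp only [Finset.sum_insert ha]
    exact (hσ.add_le _ _ (hf a) (Finset.aemeasurable_fun_sum _ fun i _ => hf i)).trans (by gcongr)

theorem stepFun_comp_perm {ι : Type*} [Fintype ι] {E : ι → Set ℝ} (hE : ∀ i, MeasurableSet (E i))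
    (hd : Pairwise (Disjoint on E)) {m : ℝ≥0∞} (hm : ∀ i, μ (E i) = m) (y : ι → ℝ≥0∞)
    (π : Equiv.Perm ι) : σ (stepFun E fun i => y (π i)) = σ (stepFun E y) := by
  refine hσ.rearrangement_invariant _ _ (measurable_stepFun hE _).aemeasurable
    (measurable_stepFun hE _).aemeasurable fun a => ?_
  simp only [distr_stepFun hE hd, hm]
  exact Equiv.sum_comp π fun i => if a < y i then m else 0

theorem stepFun_le_of_convexCombination {ι : Type*} [Fintype ι] [DecidableEq ι] {E : ι → Set ℝ}
    (hE : ∀ i, MeasurableSet (E i)) (hd : Pairwise (Disjoint on E)) {m : ℝ≥0∞}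
    (hm : ∀ i, μ (E i) = m) {x y : ι → ℝ≥0∞} {w : Equiv.Perm ι → ℝ≥0} (hw : ∑ π, w π = 1)
    (hxy : ∀ i, x i ≤ ∑ π, w π * y (π i)) : σ (stepFun E x) ≤ σ (stepFun E y) := by
  have hmeas : ∀ z, AEMeasurable (stepFun E z) μ := fun z => (measurable_stepFun hE z).aemeasurable
  have hle : ∀ s, stepFun E x s ≤ ∑ π, w π * stepFun E (fun i => y (π i)) s := fun s => by
    by_cases hs : ∃ i, s ∈ E i
    · obtain ⟨i, hi⟩ := hs
      simpa only [stepFun_of_mem hd _ hi] using hxy i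
    · rw [stepFun_of_notMem x (not_exists.1 hs)]
      exact zero_le
  calc σ (stepFun E x) ≤ σ fun s => ∑ π, w π * stepFun E (fun i => y (π i)) s :=
        hσ.mono _ _ (hmeas x) (Finset.aemeasurable_fun_sum _ fun π _ => (hmeas _).const_mul _)
          (.of_forall hle)
    _ ≤ ∑ π, σ fun s => w π * stepFun E (fun i => y (π i)) s :=
        hσ.sum_le _ fun π => (hmeas _).const_mul _
    _ = ∑ π, w π * σ (stepFun E y) := by
        simp only [hσ.smul _ _ (hmeas _), hσ.stepFun_comp_perm hE hd hm]
    _ = σ (stepFun E y) := by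
        rw [← Finset.sum_mul, ← ENNReal.ofNNReal_finsetSum, hw, ENNReal.coe_one, one_mul]

theorem stepFun_le_of_sum_range_le {n : ℕ} {E : Fin n → Set ℝ} (hE : ∀ i, MeasurableSet (E i))
    (hd : Pairwise (Disjoint on E)) {m : ℝ≥0∞} (hm : ∀ i, μ (E i) = m) {p q : ℕ → ℝ≥0∞}
    (hp : Antitone p) (hq : ∀ i, q i ≠ ∞)
    (hsum : ∀ k, ∑ i ∈ Finset.range k, p i ≤ ∑ i ∈ Finset.range k, q i) :
    σ (stepFun E fun i => p i) ≤ σ (stepFun E fun i => q i) := by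
  have hp_top : ∀ i, p i ≠ ∞ := fun i => ne_top_of_le_ne_top
    (ENNReal.sum_ne_top.2 fun j _ => hq j) <|
    (Finset.single_le_sum (fun _ _ => zero_le) (Finset.self_mem_range_succ i)).trans (hsum (i + 1))
  have hsum' : ∀ k, ∑ i ∈ Finset.range k, (p i).toReal ≤ ∑ i ∈ Finset.range k, (q i).toReal :=
    fun k => by
      rw [← ENNReal.toReal_sum fun i _ => hp_top i, ← ENNReal.toReal_sum fun i _ => hq i]
      exact ENNReal.toReal_mono (ENNReal.sum_ne_top.2 fun i _ => hq i) (hsum k)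
  obtain ⟨w, hw, hpq⟩ := exists_le_convexCombination_perm n
    (fun i j hij => ENNReal.toReal_mono (hp_top i) (hp hij)) hsum'
  refine hσ.stepFun_le_of_convexCombination hE hd hm (w := fun π => (w π).toNNReal) ?_ fun i => ?_
  · rw [← Real.toNNReal_sum_of_nonneg fun π _ => hw.1 π, hw.2, Real.toNNReal_one]
  · calc p i = ENNReal.ofReal (p i).toReal := (ENNReal.ofReal_toReal (hp_top i)).symm
      _ ≤ ENNReal.ofReal (∑ π, w π * (q (π i)).toReal) := ENNReal.ofReal_le_ofReal (hpq i)
      _ = ∑ π, ENNReal.ofReal (w π) * q (π i : Fin n) := by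
          rw [ENNReal.ofReal_sum_of_nonneg fun π _ => mul_nonneg (hw.1 π) ENNReal.toReal_nonneg]
          simp only [ENNReal.ofReal_mul (hw.1 _), ENNReal.ofReal_toReal (hq _)]

end IsRIBanachFunctionNorm

theorem lintegral_Ioc_natCast_mul (F : ℝ → ℝ≥0∞) {h : ℝ} (hh : 0 ≤ h) (k : ℕ) :
    ∫⁻ s in Ioc 0 (k * h), F s =
      ∑ i ∈ Finset.range k, ∫⁻ s in Ioc (i * h) ((i + 1) * h), F s := by
  induction k with
  | zero => simp
  | succ k ih =>
    rw [Finset.sum_range_succ, ← ih, Nat.cast_succ,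
      lintegral_Ioc_add F (by positivity) (by gcongr; simp)]

theorem volume_Ioc_mul (a h : ℝ) : volume (Ioc (a * h) ((a + 1) * h)) = ENNReal.ofReal h := by
  rw [Real.volume_Ioc]; congr 1; ring

theorem mul_sum_le_lintegral {P : ℝ → ℝ≥0∞} (hP : Antitone P) {h : ℝ} (hh : 0 ≤ h) (k : ℕ) :
    ENNReal.ofReal h * ∑ i ∈ Finset.range k, P ((i + 1) * h) ≤ ∫⁻ s in Ioc 0 (k * h), P s := by
  rw [lintegral_Ioc_natCast_mul P hh, Finset.mul_sum]
  refine Finset.sum_le_sum fun i _ => ?_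
  rw [← volume_Ioc_mul i h, mul_comm, ← setLIntegral_const]
  exact setLIntegral_mono hP.measurable fun s hs => hP hs.2

theorem lintegral_add_right_le_mul_sum {Q : ℝ → ℝ≥0∞} (hQ : Antitone Q) {h : ℝ} (hh : 0 ≤ h)
    (k : ℕ) :
    ∫⁻ s in Ioc 0 (k * h), Q (s + h) ≤
      ENNReal.ofReal h * ∑ i ∈ Finset.range k, Q ((i + 1) * h) := by
  rw [lintegral_Ioc_natCast_mul _ hh, Finset.mul_sum]
  refine Finset.sum_le_sum fun i _ => ?_
  rw [← volume_Ioc_mul i h, mul_comm (volume _), ← setLIntegral_const]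
  exact setLIntegral_mono measurable_const fun s hs => hQ (by linarith [hs.1])

/-- The step function equal to `P (k * h)` on each cell `((k - 1) * h, k * h]`, `1 ≤ k ≤ n`. -/
noncomputable def lowerStep (P : ℝ → ℝ≥0∞) (h : ℝ) (n : ℕ) : ℝ → ℝ≥0∞ :=
  stepFun (fun i : Fin n => Ioc (i * h) ((i + 1) * h)) fun i => P ((i + 1) * h)

theorem pairwise_disjoint_Ioc_mul {h : ℝ} (hh : 0 ≤ h) (n : ℕ) :
    Pairwise (Disjoint on fun i : Fin n => Ioc (i * h) ((i + 1) * h)) := by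
  have hmono : Monotone fun i : ℕ => i * h := fun i j hij => by beta_reduce; gcongr
  simpa using hmono.pairwise_disjoint_on_Ioc_succ.comp_of_injective Fin.val_injective

theorem lowerStep_le {P : ℝ → ℝ≥0∞} (hP : Antitone P) {h : ℝ} (hh : 0 ≤ h) (n : ℕ) (s : ℝ) :
    lowerStep P h n s ≤ P s := by
  by_cases hs : ∃ i : Fin n, s ∈ Ioc (i * h) ((i + 1) * h)
  · obtain ⟨i, hi⟩ := hs
    rw [lowerStep, stepFun_of_mem (pairwise_disjoint_Ioc_mul hh n) _ hi]
    exact hP hi.2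
  · rw [lowerStep, stepFun_of_notMem _ (not_exists.1 hs)]
    exact zero_le

theorem IsRIBanachFunctionNorm.lowerStep_le_of_lintegral_le {σ : (ℝ → ℝ≥0∞) → ℝ≥0∞}
    (hσ : IsRIBanachFunctionNorm σ) {P Q : ℝ → ℝ≥0∞} (hP : Antitone P) (hQ : Antitone Q)
    (hQ_top : ∀ t, 0 < t → Q t ≠ ∞) {h : ℝ} (hh : 0 < h)
    (hPQ : ∀ t, 0 < t → ∫⁻ s in Ioc 0 t, P s ≤ ∫⁻ s in Ioc 0 t, Q (s + h)) (n : ℕ) :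
    σ (lowerStep P h n) ≤ σ Q := by
  have hsum : ∀ k, ∑ i ∈ Finset.range k, P ((i + 1) * h) ≤ ∑ i ∈ Finset.range k, Q ((i + 1) * h) :=
    fun k => by
      rcases k.eq_zero_or_pos with rfl | hk
      · simp
      refine (ENNReal.mul_le_mul_iff_right (a := ENNReal.ofReal h) (by simpa) (by simp)).1 ?_
      exact ((mul_sum_le_lintegral hP hh.le k).trans (hPQ _ (by positivity))).trans
        (lintegral_add_right_le_mul_sum hQ hh.le k)
  have hcells : ∀ i : Fin n, μ (Ioc (i * h) ((i + 1) * h)) = ENNReal.ofReal h := fun i => by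
    rw [μ, Measure.restrict_apply measurableSet_Ioc, inter_eq_left.2, volume_Ioc_mul]
    exact fun s hs => (show (0 : ℝ) ≤ i * h by positivity).trans_lt hs.1
  have hle : σ (lowerStep P h n) ≤ σ (lowerStep Q h n) :=
    hσ.stepFun_le_of_sum_range_le (fun _ => measurableSet_Ioc) (pairwise_disjoint_Ioc_mul hh.le n)
      hcells (fun i j hij => hP (by gcongr)) (fun i => hQ_top _ (by positivity)) hsum
  exact hle.trans (hσ.mono _ _ (measurable_stepFun (fun _ => measurableSet_Ioc) _).aemeasurable
    hQ.measurable.aemeasurable (.of_forall (lowerStep_le hQ hh.le n)))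

theorem lowerStep_apply (P : ℝ → ℝ≥0∞) {h s : ℝ} {n : ℕ} (hh : 0 < h) (hs : s ∈ Ioc 0 (n * h)) :
    lowerStep P h n s = P (⌈s / h⌉₊ * h) := by
  have hpos : 0 < ⌈s / h⌉₊ := Nat.ceil_pos.2 (div_pos hs.1 hh)
  have hcast : ((⌈s / h⌉₊ - 1 : ℕ) : ℝ) = ⌈s / h⌉₊ - 1 := by simp [Nat.cast_pred hpos]
  have hlt : ⌈s / h⌉₊ - 1 < n :=
    (Nat.sub_one_lt hpos.ne').trans_le (Nat.ceil_le.2 ((div_le_iff₀ hh).2 hs.2))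
  have hmem : s ∈ Ioc (((⟨_, hlt⟩ : Fin n) : ℕ) * h) ((((⟨_, hlt⟩ : Fin n) : ℕ) + 1) * h) := by
    constructor
    · rw [hcast, ← lt_div_iff₀ hh]
      linarith [Nat.ceil_lt_add_one (div_pos hs.1 hh).le]
    · rw [hcast, sub_add_cancel, ← div_le_iff₀ hh]
      exact Nat.le_ceil _
  rw [lowerStep, stepFun_of_mem (pairwise_disjoint_Ioc_mul hh.le n) _ hmem, hcast, sub_add_cancel]

theorem lowerStep_of_notMem (P : ℝ → ℝ≥0∞) {h s : ℝ} {n : ℕ} (hh : 0 ≤ h)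
    (hs : s ∉ Ioc 0 (n * h)) : lowerStep P h n s = 0 := by
  refine stepFun_of_notMem _ fun i hi => hs ⟨?_, hi.2.trans ?_⟩
  · exact (show (0 : ℝ) ≤ i * h by positivity).trans_lt hi.1
  · gcongr
    exact_mod_cast i.is_lt

theorem lowerStep_le_lowerStep_half {P : ℝ → ℝ≥0∞} (hP : Antitone P) {h : ℝ} (hh : 0 < h)
    {n k : ℕ} (hnk : 2 * n ≤ k) (s : ℝ) : lowerStep P h n s ≤ lowerStep P (h / 2) k s := by
  by_cases hs : s ∈ Ioc 0 (n * h)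
  swap
  · rw [lowerStep_of_notMem P hh.le hs]
    exact zero_le
  have hle : (n : ℝ) * h ≤ k * (h / 2) := by
    have : (2 * n : ℝ) ≤ k := by exact_mod_cast hnk
    nlinarith
  rw [lowerStep_apply P hh hs, lowerStep_apply P (half_pos hh) ⟨hs.1, hs.2.trans hle⟩]
  have hceil : ⌈s / (h / 2)⌉₊ ≤ 2 * ⌈s / h⌉₊ := Nat.ceil_le.2 <| by
    push_cast
    calc s / (h / 2) = 2 * (s / h) := by field_simp
      _ ≤ 2 * ⌈s / h⌉₊ := by gcongr; exact Nat.le_ceil _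
  refine hP ?_
  calc (⌈s / (h / 2)⌉₊ : ℝ) * (h / 2) ≤ (2 * ⌈s / h⌉₊ : ℕ) * (h / 2) := by gcongr
    _ = ⌈s / h⌉₊ * h := by push_cast; ring

theorem monotone_lowerStep {P : ℝ → ℝ≥0∞} (hP : Antitone P) (s : ℝ) :
    Monotone fun m : ℕ => lowerStep P ((1 / 2) ^ m) (4 ^ m) s := by
  refine monotone_nat_of_le_succ fun m => ?_
  rw [pow_succ (1 / 2 : ℝ), mul_one_div]
  exact lowerStep_le_lowerStep_half hP (by positivity) (by rw [pow_succ]; lia) s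

theorem iSup_lowerStep {P : ℝ → ℝ≥0∞} (hP : IsDecreasing P) {s : ℝ} (hs : 0 < s) :
    ⨆ m : ℕ, lowerStep P ((1 / 2) ^ m) (4 ^ m) s = P s := by
  refine le_antisymm (iSup_le fun m => lowerStep_le hP.antitone (by positivity) _ s)
    (le_of_forall_lt fun y hy => ?_)
  have hh : Tendsto (fun m : ℕ => (1 / 2 : ℝ) ^ m) atTop (𝓝 0) :=
    tendsto_pow_atTop_nhds_zero_of_lt_one (by norm_num) (by norm_num)
  have hright : Tendsto (fun m : ℕ => (⌈s / (1 / 2 : ℝ) ^ m⌉₊ : ℝ) * (1 / 2) ^ m) atTop (𝓝 s) := by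
    refine tendsto_of_tendsto_of_tendsto_of_le_of_le tendsto_const_nhds
      (by simpa only [add_zero] using hh.const_add s) (fun m => ?_) fun m => ?_
    · exact (div_le_iff₀ (by positivity)).1 (Nat.le_ceil _)
    · calc (⌈s / (1 / 2 : ℝ) ^ m⌉₊ : ℝ) * (1 / 2) ^ m ≤ (s / (1 / 2) ^ m + 1) * (1 / 2) ^ m := by
            gcongr; exact (Nat.ceil_lt_add_one (by positivity)).le
        _ = s + (1 / 2) ^ m := by field_simp
  have hcover : ∀ᶠ m : ℕ in atTop, s ≤ ((4 ^ m : ℕ) : ℝ) * (1 / 2) ^ m := by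
    simp only [Nat.cast_pow, ← mul_pow, Nat.cast_ofNat]
    exact (tendsto_pow_atTop_atTop_of_one_lt (by norm_num)).eventually_ge_atTop s
  obtain ⟨m, hym, hm⟩ := ((hright.eventually (hP.lowerSemicontinuous s y hy)).and hcover).exists
  refine lt_of_lt_of_le ?_ (le_iSup _ m)
  rwa [lowerStep_apply P (by positivity) ⟨hs, hm⟩]

theorem lintegral_Ioc_max_le {P Q : ℝ → ℝ≥0∞} (hP : Antitone P) (hQ : Antitone Q) {H : ℝ}
    (hH : 0 < H)
    (hPQ : ∀ t, H ≤ t → ∫⁻ s in Ioc 0 t, P (max s H) ≤ ∫⁻ s in Ioc 0 t, Q s) {t : ℝ} (ht : 0 < t) :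
    ∫⁻ s in Ioc 0 t, P (max s H) ≤ ∫⁻ s in Ioc 0 t, Q s := by
  rcases le_total H t with h | h
  · exact hPQ t h
  have hPmax : Antitone fun s => P (max s H) := fun x y hxy => hP (max_le_max_right H hxy)
  calc ∫⁻ s in Ioc 0 t, P (max s H) = ENNReal.ofReal t * P (max H H) := by
        rw [setLIntegral_congr_fun (g := fun _ => P (max H H)) measurableSet_Ioc fun s hs => by
          simp only [max_eq_right (hs.2.trans h), max_self], setLIntegral_const, Real.volume_Ioc,
          sub_zero, mul_comm]
    _ ≤ ENNReal.ofReal t * avg (fun s => P (max s H)) H := by gcongr; exact le_avg hPmax hH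
    _ ≤ ENNReal.ofReal t * avg Q H := by gcongr; exact mul_le_mul_right (hPQ H le_rfl) _
    _ ≤ ENNReal.ofReal t * avg Q t := by gcongr; exact antitoneOn_avg hQ ht hH h
    _ = ∫⁻ s in Ioc 0 t, Q s := ofReal_mul_avg ht

theorem lintegral_Ioc_le_lintegral_add_right (G : ℝ → ℝ≥0∞) {h : ℝ} (hh : 0 ≤ h) (t : ℝ) :
    ∫⁻ s in Ioc h t, G s ≤ ∫⁻ s in Ioc 0 t, G (s + h) := by
  have hpre : (· + h) ⁻¹' Ioc h (t + h) = Ioc 0 t := by ext s; simp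
  rw [← hpre, (measurePreserving_add_right volume h).setLIntegral_comp_preimage_emb
    (measurableEmbedding_addRight h)]
  exact lintegral_mono_set (Ioc_subset_Ioc_right (by linarith))

theorem eventually_lintegral_Ioc_zero_le {G : ℝ → ℝ≥0∞} (hG : ∫⁻ s in Ioc 0 1, G s ≠ ∞) {H : ℝ}
    (hH : 0 < H) {ε : ℝ≥0∞} (hε : ε ≠ 0) :
    ∀ᶠ h in 𝓝[>] 0, ∫⁻ s in Ioc 0 h, G s ≤ ε * ∫⁻ s in Ioc 0 H, G s := by
  rcases eq_or_ne (∫⁻ s in Ioc 0 H, G s) 0 with h0 | h0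
  · filter_upwards [Ioo_mem_nhdsGT hH] with h hh
    exact (lintegral_mono_set (Ioc_subset_Ioc_right hh.2.le)).trans (h0.trans_le zero_le)
  · exact (tendsto_lintegral_Ioc_zero hG).eventually_le_const
      (pos_iff_ne_zero.2 (mul_ne_zero hε h0))

theorem eventually_lintegral_Ioc_max_le {F G : ℝ → ℝ≥0∞} (hF : Antitone F) (hG : Antitone G)
    (hG₁ : ∫⁻ s in Ioc 0 1, G s ≠ ∞)
    (hFG : ∀ t, 0 < t → ∫⁻ s in Ioc 0 t, F s ≤ ∫⁻ s in Ioc 0 t, G s) {c : ℝ≥0∞} (hc : c < 1)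
    {H : ℝ} (hH : 0 < H) :
    ∀ᶠ h in 𝓝[>] 0, ∀ t, 0 < t →
      ∫⁻ s in Ioc 0 t, c * F (max s H) ≤ ∫⁻ s in Ioc 0 t, G (s + h) := by
  filter_upwards [eventually_lintegral_Ioc_zero_le hG₁ hH (tsub_pos_of_lt hc).ne',
    Ioo_mem_nhdsGT (lt_min hH one_pos)] with h hsmall hh t ht
  refine lintegral_Ioc_max_le (P := fun s => c * F s)
    (fun x y hxy => mul_le_mul_right (hF hxy) c) (fun x y hxy => hG (by gcongr)) hH
    (fun t hHt => ?_) ht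
  have hhH : h < H := hh.2.trans_le (min_le_left _ _)
  have hfin : ∫⁻ s in Ioc 0 h, G s ≠ ∞ := ne_top_of_le_ne_top hG₁
    (lintegral_mono_set (Ioc_subset_Ioc_right (hh.2.le.trans (min_le_right _ _))))
  have hFt : ∫⁻ s in Ioc 0 t, c * F (max s H) ≤ c * ∫⁻ s in Ioc 0 t, G s := by
    rw [lintegral_const_mul' _ _ hc.ne_top]
    exact mul_le_mul_right
      ((lintegral_mono fun s => hF (le_max_left s H)).trans (hFG t (hH.trans_le hHt))) c
  refine (ENNReal.add_le_add_iff_left hfin).1 ?_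
  calc (∫⁻ s in Ioc 0 h, G s) + ∫⁻ s in Ioc 0 t, c * F (max s H)
      ≤ (1 - c) * (∫⁻ s in Ioc 0 t, G s) + c * ∫⁻ s in Ioc 0 t, G s := by
        gcongr
        exact hsmall.trans (by gcongr)
    _ = ∫⁻ s in Ioc 0 t, G s := by rw [← add_mul, tsub_add_cancel_of_le hc.le, one_mul]
    _ = (∫⁻ s in Ioc 0 h, G s) + ∫⁻ s in Ioc h t, G s :=
        (lintegral_Ioc_add G hh.1.le (hhH.le.trans hHt)).symm
    _ ≤ (∫⁻ s in Ioc 0 h, G s) + ∫⁻ s in Ioc 0 t, G (s + h) := by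
        gcongr (∫⁻ s in Ioc 0 h, G s) + ?_; exact lintegral_Ioc_le_lintegral_add_right G hh.1.le t

theorem IsDecreasing.comp_max {F : ℝ → ℝ≥0∞} (hF : IsDecreasing F) (H : ℝ) :
    IsDecreasing fun s => F (max s H) :=
  ⟨fun _ _ hxy => hF.antitone (max_le_max_right H hxy),
    hF.lowerSemicontinuous.comp (continuous_id.max continuous_const)⟩

namespace IsRIBanachFunctionNorm

variable {σ : (ℝ → ℝ≥0∞) → ℝ≥0∞} (hσ : IsRIBanachFunctionNorm σ)

include hσ

theorem const_mul_comp_max_le {F G : ℝ → ℝ≥0∞} (hF : IsDecreasing F) (hG : Antitone G)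
    (hG_top : ∀ t, 0 < t → ∫⁻ s in Ioc 0 t, G s < ∞)
    (hFG : ∀ t, 0 < t → ∫⁻ s in Ioc 0 t, F s ≤ ∫⁻ s in Ioc 0 t, G s) {c : ℝ≥0∞} (hc : c < 1)
    {H : ℝ} (hH : 0 < H) : σ (fun s => c * F (max s H)) ≤ σ G := by
  have hP : IsDecreasing fun s => c * F (max s H) := (hF.comp_max H).const_mul hc.ne_top
  set p : ℕ → ℝ → ℝ≥0∞ := fun m => lowerStep (fun s => c * F (max s H)) ((1 / 2) ^ m) (4 ^ m)
  have hmeas : ∀ m, AEMeasurable (p m) μ :=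
    fun m => (measurable_stepFun (fun _ => measurableSet_Ioc) _).aemeasurable
  have hsup : σ (fun s => c * F (max s H)) = ⨆ m, σ (p m) := by
    rw [← hσ.fatou _ hmeas (.of_forall fun s => monotone_lowerStep hP.antitone s)]
    exact hσ.rearrangement_invariant _ _ hP.measurable.aemeasurable (.iSup hmeas)
      (distr_congr (ae_μ_of_forall fun s hs => (iSup_lowerStep hP hs).symm))
  have hmono : Monotone fun m => σ (p m) :=
    fun m k hmk => hσ.mono _ _ (hmeas m) (hmeas k)
      (.of_forall fun s => monotone_lowerStep hP.antitone s hmk)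
  have hG_ne_top : ∀ t, 0 < t → G t ≠ ∞ := fun t ht =>
    (lt_top_of_antitoneOn (hG.antitoneOn _) ht (hG_top t ht)).ne
  rw [hsup]
  refine le_of_tendsto (tendsto_atTop_iSup hmono) ?_
  have hhalf : Tendsto (fun m : ℕ => (1 / 2 : ℝ) ^ m) atTop (𝓝[>] 0) :=
    tendsto_pow_atTop_nhdsWithin_zero_of_lt_one (by norm_num) (by norm_num)
  filter_upwards [hhalf.eventually (eventually_lintegral_Ioc_max_le hF.antitone hG
    (hG_top 1 one_pos).ne hFG hc hH)] with m hm
  exact hσ.lowerStep_le_of_lintegral_le hP.antitone hG hG_ne_top (by positivity) hm _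

theorem le_of_lintegral_Ioc_le {F G : ℝ → ℝ≥0∞} (hF : IsDecreasing F) (hG : Antitone G)
    (hG_top : ∀ t, 0 < t → ∫⁻ s in Ioc 0 t, G s < ∞)
    (hFG : ∀ t, 0 < t → ∫⁻ s in Ioc 0 t, F s ≤ ∫⁻ s in Ioc 0 t, G s) : σ F ≤ σ G := by
  have hmeas : ∀ k : ℕ, AEMeasurable (fun s => F (max s (1 / (k + 1)))) μ := fun k =>
    (hF.comp_max _).measurable.aemeasurable
  have hmono : ∀ s, Monotone fun k : ℕ => F (max s (1 / (k + 1))) := fun s k l hkl =>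
    hF.antitone (max_le_max_left s (Nat.one_div_le_one_div hkl))
  have hsup : ∀ s, 0 < s → F s = ⨆ k : ℕ, F (max s (1 / (k + 1))) := fun s hs => by
    obtain ⟨k, hk⟩ := exists_nat_one_div_lt hs
    refine le_antisymm (le_iSup_of_le k ?_) (iSup_le fun _ => hF.antitone (le_max_left _ _))
    rw [max_eq_left hk.le]
  rw [hσ.rearrangement_invariant _ _ hF.measurable.aemeasurable (.iSup hmeas)
    (distr_congr (ae_μ_of_forall hsup)), hσ.fatou _ hmeas (.of_forall hmono)]
  refine iSup_le fun k => ENNReal.le_of_forall_lt_one_mul_le fun c hc => ?_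
  lift c to ℝ≥0 using hc.ne_top
  rw [← hσ.smul _ _ (hmeas k)]
  exact hσ.const_mul_comp_max_le hF hG hG_top hFG hc Nat.one_div_pos_of_nat

theorem lintegral_Ioc_rearr_lt_top {f : ℝ → ℝ≥0∞} (hf : AEMeasurable f μ) (h : σ f < ∞) (t : ℝ) :
    ∫⁻ s in Ioc 0 t, rearr f s < ∞ := by
  obtain ⟨C, hC⟩ := hσ.lintegral_le (Ioc 0 t) measurableSet_Ioc (by simp [μ_Ioc])
  have hCf := hC _ (measurable_rearr f).aemeasurable
  rw [μ_restrict_Ioc, hσ.rearrangement_invariant _ f (measurable_rearr f).aemeasurable hf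
    (distr_rearr f)] at hCf
  exact hCf.trans_lt (ENNReal.mul_lt_top ENNReal.coe_lt_top h)

theorem le_of_submajorized {f g : ℝ → ℝ≥0∞} (hf : AEMeasurable f μ) (hg : AEMeasurable g μ)
    (h : Submajorized f g) : σ f ≤ σ g := by
  rcases eq_top_or_lt_top (σ g) with hσg | hσg
  · exact hσg ▸ le_top
  rw [← hσ.rearrangement_invariant _ f (measurable_rearr f).aemeasurable hf (distr_rearr f),
    ← hσ.rearrangement_invariant _ g (measurable_rearr g).aemeasurable hg (distr_rearr g)]
  exact hσ.le_of_lintegral_Ioc_le (isDecreasing_rearr f) (antitone_rearr g)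
    (fun t _ => hσ.lintegral_Ioc_rearr_lt_top hg hσg t) h

end IsRIBanachFunctionNorm

/-! ### Minimality and necessity of the growth condition -/

section Minimality

variable {φ : ℝ → ℝ} {hφ : QuasiConcave φ} {ρ σ : (ℝ → ℝ≥0∞) → ℝ≥0∞}

theorem HardyBounded.functionSpace_rangeNorm_subset (hσ : IsRIBanachFunctionNorm σ)
    (hb : HardyBounded hφ σ) : functionSpace (rangeNorm hφ) ⊆ functionSpace σ := by
  rintro f ⟨hf, hlt⟩
  obtain ⟨C, hC⟩ := hb
  simp only [rangeNorm, iInf_lt_iff] at hlt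
  obtain ⟨g, ⟨-, hg⟩, -⟩ := hlt
  have hfg : Submajorized (absFun f) (absFun (hardy g)) := fun t ht =>
    (maxRearr_le_iff ht).1 (hg.2.2 t ht)
  refine ⟨hf, ?_⟩
  calc σ (absFun f) ≤ σ (absFun (hardy g)) :=
        hσ.le_of_submajorized hf.enorm (aemeasurable_hardy hg.2.1.1).enorm hfg
    _ ≤ C * lorentzNorm hφ g := hC g hg.2.1
    _ < ∞ := ENNReal.mul_lt_top ENNReal.coe_lt_top hg.2.1.2

theorem isMinimalRange_rangeNorm (hφ : QuasiConcave φ) (hgr : Growth φ) :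
    IsMinimalRange hφ (rangeNorm hφ) where
  isRI := isRIBanachFunctionNorm_rangeNorm hφ hgr
  bounded := hardyBounded_rangeNorm hφ hgr
  minimal _ hσ hb := hb.functionSpace_rangeNorm_subset hσ

theorem IsMinimalRange.functionSpace_eq (hρ : IsMinimalRange hφ ρ) (hσ : IsMinimalRange hφ σ) :
    functionSpace ρ = functionSpace σ :=
  (hρ.minimal σ hσ.isRI hσ.bounded).antisymm (hσ.minimal ρ hρ.isRI hρ.bounded)

theorem HardyBounded.exists_lintegral_avgMeasure_one_le (hσ : IsRIBanachFunctionNorm σ)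
    (hb : HardyBounded hφ σ) : ∃ A : ℝ≥0, ∀ G, IsDecreasing G → ∫⁻ x, G x ∂hφ.dφ < ∞ →
      ∫⁻ x, G x ∂avgMeasure 1 ≤ A * ∫⁻ x, G x ∂hφ.dφ := by
  obtain ⟨C, hC⟩ := hb
  obtain ⟨K, hK⟩ := hσ.lintegral_le (Ioc 0 1) measurableSet_Ioc (by simp [μ_Ioc])
  refine ⟨K * C, fun G hG hfin => ?_⟩
  set g : ℝ → ℝ := fun x => (G x).toReal
  have hnorm : lorentzNorm hφ g ≤ ∫⁻ x, G x ∂hφ.dφ := lorentzNorm_toReal_le hφ hG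
  have hg : g ∈ lorentzSpace hφ :=
    ⟨hG.measurable.ennreal_toReal.aemeasurable, hnorm.trans_lt hfin⟩
  calc ∫⁻ x, G x ∂avgMeasure 1 = ∫⁻ x in Ioc 0 1, absFun (hardy g) x ∂μ := by
        rw [lintegral_avgMeasure hG.measurable, μ_restrict_Ioc]
        exact (setLIntegral_congr_fun measurableSet_Ioc fun x hx =>
          absFun_hardy_toReal hφ hG hfin hx.1).symm
    _ ≤ K * σ (absFun (hardy g)) := hK _ (aemeasurable_hardy hg.1).enorm
    _ ≤ K * (C * ∫⁻ x, G x ∂hφ.dφ) := by gcongr; exact (hC g hg).trans (by gcongr)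
    _ = (K * C : ℝ≥0) * ∫⁻ x, G x ∂hφ.dφ := by push_cast; ring

theorem HardyBounded.exists_mul_one_add_log_le (hσ : IsRIBanachFunctionNorm σ)
    (hb : HardyBounded hφ σ) :
    ∃ A : ℝ≥0, ∀ t, 0 < t → t ≤ 1 → t * (1 + Real.log (1 / t)) ≤ A * φ t := by
  obtain ⟨A, hA⟩ := hb.exists_lintegral_avgMeasure_one_le hσ
  refine ⟨A, fun t ht ht₁ => ?_⟩
  have hnorm : ∫⁻ x, (Iio t).indicator 1 x ∂hφ.dφ = ENNReal.ofReal (φ t) := by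
    rw [lintegral_indicator_one measurableSet_Iio, hφ.dφ_Iio ht]
  have hle := hA _ (isDecreasing_indicator_Iio t) (hnorm ▸ ENNReal.ofReal_lt_top)
  rwa [hnorm, lintegral_indicator_one measurableSet_Iio, avgMeasure_Iio_of_ge ht ht₁,
    ← ENNReal.ofReal_coe_nnreal, ← ENNReal.ofReal_mul A.coe_nonneg,
    ENNReal.ofReal_le_ofReal_iff (mul_nonneg A.coe_nonneg (hφ.pos t ht).le)] at hle

theorem mul_log_one_add_le {t : ℝ} (ht : 0 < t) (ht₁ : t ≤ 1) :
    t * Real.log (1 + 1 / t) ≤ t * (1 + Real.log (1 / t)) := by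
  have hlog : Real.log (1 + 1 / t) ≤ Real.log (2 * (1 / t)) :=
    Real.log_le_log (by positivity) (by linarith [(one_le_div ht).2 ht₁])
  rw [Real.log_mul two_ne_zero (by positivity)] at hlog
  gcongr
  linarith [Real.log_two_lt_d9]

theorem mul_log_one_add_le_one {t : ℝ} (ht : 0 < t) : t * Real.log (1 + 1 / t) ≤ 1 :=
  calc t * Real.log (1 + 1 / t) ≤ t * (1 / t) := by
        gcongr; linarith [Real.log_le_sub_one_of_pos (show 0 < 1 + 1 / t by positivity)]
    _ = 1 := by field_simp

theorem HardyBounded.growth (hσ : IsRIBanachFunctionNorm σ) (hb : HardyBounded hφ σ) :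
    Growth φ := by
  obtain ⟨A, hA⟩ := hb.exists_mul_one_add_log_le hσ
  have hA₁ : 1 ≤ A * φ 1 := by simpa using hA 1 one_pos le_rfl
  have hA₀ : (0 : ℝ) < A := pos_of_mul_pos_left (one_pos.trans_le hA₁) (hφ.pos 1 one_pos).le
  refine ⟨(A : ℝ)⁻¹, inv_pos.2 hA₀, fun t ht => (inv_mul_le_iff₀ hA₀).2 ?_⟩
  rcases le_total t 1 with h | h
  · exact (mul_log_one_add_le ht h).trans (hA t ht h)
  · calc t * Real.log (1 + 1 / t) ≤ 1 := mul_log_one_add_le_one ht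
      _ ≤ A * φ 1 := hA₁
      _ ≤ A * φ t := by gcongr; exact hφ.mono (mem_Ioi.2 one_pos) ht h

theorem IsMinimalRange.growth (hρ : IsMinimalRange hφ ρ) : Growth φ := hρ.bounded.growth hρ.isRI

end Minimality

namespace IsRIBanachFunctionNorm

variable {ρ σ : (ℝ → ℝ≥0∞) → ℝ≥0∞} (hρ : IsRIBanachFunctionNorm ρ)

include hρ

theorem ae_lt_top {f : ℝ → ℝ≥0∞} (hf : AEMeasurable f μ) (h : ρ f < ∞) : ∀ᵐ x ∂μ, f x < ∞ :=
  ae_lt_top_of_lintegral_rearr_lt_top hf one_pos (hρ.lintegral_Ioc_rearr_lt_top hf h 1)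

theorem tsum_le {f : ℕ → ℝ → ℝ≥0∞} (hf : ∀ n, AEMeasurable (f n) μ) :
    ρ (fun x => ∑' n, f n x) ≤ ∑' n, ρ (f n) := by
  simp only [ENNReal.tsum_eq_iSup_nat]
  rw [hρ.fatou _ (fun n => Finset.aemeasurable_fun_sum _ fun j _ => hf j)
    (.of_forall fun x m n hmn => Finset.sum_le_sum_of_subset (Finset.range_subset_range.2 hmn))]
  exact iSup_mono fun n => hρ.sum_le _ hf

theorem exists_eq_one_of_mul_lt (hσ : IsRIBanachFunctionNorm σ) {N : ℝ≥0} (hN : N ≠ 0)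
    {f : ℝ → ℝ≥0∞} (hf : AEMeasurable f μ) (hlt : N * ρ f < σ f) :
    ∃ g, AEMeasurable g μ ∧ ρ g = 1 ∧ N ≤ σ g := by
  have htop : ρ f ≠ ∞ := fun h => by simp [h, ENNReal.mul_top, hN] at hlt
  have hzero : ρ f ≠ 0 := fun h => by
    rw [(hσ.eq_zero_iff f hf).2 ((hρ.eq_zero_iff f hf).1 h)] at hlt
    exact not_lt_zero hlt
  lift ρ f to ℝ≥0 using htop with r hr
  have hinv : ((r⁻¹ : ℝ≥0) : ℝ≥0∞) = (r : ℝ≥0∞)⁻¹ := ENNReal.coe_inv (by simpa using hzero)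
  refine ⟨fun x => (r⁻¹ : ℝ≥0) * f x, hf.const_mul _, ?_, ?_⟩
  · rw [hρ.smul _ _ hf, ← hr, hinv, ENNReal.inv_mul_cancel hzero ENNReal.coe_ne_top]
  · rw [hσ.smul _ _ hf, hinv, ← ENNReal.div_eq_inv_mul,
      ENNReal.le_div_iff_mul_le (.inl hzero) (.inl ENNReal.coe_ne_top)]
    exact hlt.le

theorem lt_top_of_functionSpace_subset (hσ : IsRIBanachFunctionNorm σ)
    (hsub : functionSpace ρ ⊆ functionSpace σ) {f : ℝ → ℝ≥0∞} (hf : AEMeasurable f μ)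
    (h : ρ f < ∞) : σ f < ∞ := by
  have hf' : AEMeasurable (absFun fun x => (f x).toReal) μ := hf.ennreal_toReal.enorm
  have hae := absFun_toReal_ae_eq (hρ.ae_lt_top hf h)
  rw [← hσ.rearrangement_invariant _ f hf' hf (distr_congr hae)]
  rw [← hρ.rearrangement_invariant _ f hf' hf (distr_congr hae)] at h
  exact (hsub ⟨hf.ennreal_toReal, h⟩).2

theorem exists_le_of_functionSpace_subset (hσ : IsRIBanachFunctionNorm σ)
    (hsub : functionSpace ρ ⊆ functionSpace σ) :
    ∃ C : ℝ≥0, 0 < C ∧ ∀ f, AEMeasurable f μ → σ f ≤ C * ρ f := by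
  by_contra! hcon
  have hunit : ∀ n : ℕ, ∃ f, AEMeasurable f μ ∧ ρ f = 1 ∧
      (((n + 1) * 2 ^ (n + 1) : ℝ≥0) : ℝ≥0∞) ≤ σ f := fun n => by
    obtain ⟨f, hf, hlt⟩ := hcon ((n + 1) * 2 ^ (n + 1)) (by positivity)
    exact hρ.exists_eq_one_of_mul_lt hσ (by positivity) hf hlt
  choose f hf hρf hσf using hunit
  set w : ℕ → ℝ≥0 := fun n => 2⁻¹ ^ (n + 1)
  have hw : ∀ n, AEMeasurable (fun x => w n * f n x) μ := fun n => (hf n).const_mul _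
  have hρ_lt : ρ (fun x => ∑' n, w n * f n x) < ∞ := by
    refine (hρ.tsum_le hw).trans_lt ?_
    simp_rw [fun n => hρ.smul (w n) _ (hf n), hρf, mul_one, w, ENNReal.coe_pow,
      ENNReal.coe_inv two_ne_zero, ENNReal.coe_ofNat, ENNReal.tsum_geometric_add_one,
      ENNReal.one_sub_inv_two, inv_inv]
    exact ENNReal.mul_lt_top (by simp) (by simp)
  have hσ_ge : ∀ n : ℕ, (n : ℝ≥0∞) ≤ σ fun x => ∑' n, w n * f n x := fun n => by
    calc (n : ℝ≥0∞) ≤ ((n + 1 : ℝ≥0) : ℝ≥0∞) := by push_cast; exact le_self_add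
      _ = w n * (((n + 1) * 2 ^ (n + 1) : ℝ≥0) : ℝ≥0∞) := by
          rw [← ENNReal.coe_mul, mul_left_comm, ← mul_pow, inv_mul_cancel₀ two_ne_zero, one_pow,
            mul_one]
      _ ≤ w n * σ (f n) := by gcongr; exact hσf n
      _ = σ fun x => w n * f n x := (hσ.smul _ _ (hf n)).symm
      _ ≤ σ fun x => ∑' n, w n * f n x :=
          hσ.mono _ _ (hw n) (.tsum hw) (.of_forall fun x => ENNReal.le_tsum n)
  obtain ⟨n, hn⟩ := ENNReal.exists_nat_gt
    (hρ.lt_top_of_functionSpace_subset hσ hsub (.tsum hw) hρ_lt).ne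
  exact (hσ_ge n).not_gt hn

theorem exists_equiv_of_functionSpace_eq (hσ : IsRIBanachFunctionNorm σ)
    (h : functionSpace ρ = functionSpace σ) : ∃ c C : ℝ≥0, 0 < c ∧ 0 < C ∧
      ∀ f, AEMeasurable f μ → c * σ f ≤ ρ f ∧ ρ f ≤ C * σ f := by
  obtain ⟨K, hK₀, hK⟩ := hρ.exists_le_of_functionSpace_subset hσ h.subset
  obtain ⟨C, hC₀, hC⟩ := hσ.exists_le_of_functionSpace_subset hρ h.superset
  refine ⟨K⁻¹, C, inv_pos.2 hK₀, hC₀, fun f hf => ⟨?_, hC f hf⟩⟩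
  rw [ENNReal.coe_inv hK₀.ne', ← ENNReal.div_eq_inv_mul]
  exact ENNReal.div_le_of_le_mul' (hK f hf)

end IsRIBanachFunctionNorm

end HardyRange

theorem theorem2p3 (φ : ℝ → ℝ) (hφ : HardyRange.QuasiConcave φ) :
    -- the growth condition holds if and only if the minimal range space exists
    ((∃ C : ℝ, 0 < C ∧ ∀ t : ℝ, 0 < t → C * (t * Real.log (1 + 1 / t)) ≤ φ t) ↔
      ∃ ρ, HardyRange.IsMinimalRange hφ ρ) ∧
    -- in this case, the explicit space with its norm is a minimal range space ...
    ((∃ ρ, HardyRange.IsMinimalRange hφ ρ) →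
      HardyRange.IsMinimalRange hφ (HardyRange.rangeNorm hφ) ∧
      HardyRange.functionSpace (HardyRange.rangeNorm hφ) = HardyRange.rangeSpace hφ) ∧
    -- ... and every minimal range space coincides with it, with equivalent norms
    (∀ ρ, HardyRange.IsMinimalRange hφ ρ →
      HardyRange.functionSpace ρ = HardyRange.rangeSpace hφ ∧
      ∃ c C : NNReal, 0 < c ∧ 0 < C ∧ ∀ f ∈ HardyRange.rangeSpace hφ,
        c * HardyRange.rangeNorm hφ (HardyRange.absFun f) ≤ ρ (HardyRange.absFun f) ∧
        ρ (HardyRange.absFun f) ≤ C * HardyRange.rangeNorm hφ (HardyRange.absFun f)) := by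
  have hmin : ∀ ρ, HardyRange.IsMinimalRange hφ ρ →
      HardyRange.IsMinimalRange hφ (HardyRange.rangeNorm hφ) ∧
      HardyRange.functionSpace (HardyRange.rangeNorm hφ) = HardyRange.rangeSpace hφ := fun ρ hρ =>
    ⟨HardyRange.isMinimalRange_rangeNorm hφ hρ.growth,
      HardyRange.functionSpace_rangeNorm hφ hρ.growth⟩
  refine ⟨⟨fun hgr => ⟨_, HardyRange.isMinimalRange_rangeNorm hφ hgr⟩, fun ⟨_, hρ⟩ => hρ.growth⟩,
    fun ⟨ρ, hρ⟩ => hmin ρ hρ, fun ρ hρ => ?_⟩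
  obtain ⟨hrange, hspace⟩ := hmin ρ hρ
  have heq := hρ.functionSpace_eq hrange
  obtain ⟨c, C, hc, hC, hequiv⟩ := hρ.isRI.exists_equiv_of_functionSpace_eq hrange.isRI heq
  refine ⟨heq.trans hspace, c, C, hc, hC, fun f hf => hequiv _ ?_⟩
  exact (hspace.superset hf).1.enorm
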